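/- Let $L\ge 0$ be an integer, let $\mathcal G$ be a compact subgroup of the orthogonal group $\mathrm O(L)$ acting on $\mathbb R^L$, and let $G$ be distributed according to the Haar probability measure on $\mathcal G$. For $\sigma>0$ and $\theta\in\mathbb R^L$ let $\mathrm P_\theta$ denote the law of $Y=G\theta+\sigma\xi$, where $\xi\sim\mathcal N(0,I_L)$ is independent of $G$. For $\theta,\phi\in\mathbb R^L$ put $\rho(\theta,\phi)=\min_{g\in\mathcal G}\|\theta-g\phi\|$, where $\|\cdot\|$ is the Euclidean norm, and $\Delta_m=\mathbb E[(G\theta)^{\otimes m}]-\mathbb E[(G\phi)^{\otimes m}]$, with $\|\Delta_m\|$ its Hilbert--Schmidt (entrywise $\ell_2$) norm. Let $D(\mathrm P\,\|\,\mathrm Q)$ be the Kullback--Leibler divergence. There exist universal constants $\underline C,\overline C>0$ (depending on none of $L,\mathcal G,\sigma,\theta,\phi,k$) such that the following holds. If $3\rho(\theta,\phi)\le\|\theta\|\le\sigma$ and $\mathbb E[G\theta]=\mathbb E[G\phi]=0$, then for every integer $k\ge1$ $$\underline C\sum_{m=1}^{\infty}\frac{\|\Delta_m\|^2}{(\sqrt3\,\sigma)^{2m}\,m!}\;\le\;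 D(\mathrm P_\theta\,\|\,\mathrm P_\phi)\;\le\; 2\sum_{m=1}^{k-1}\frac{\|\Delta_m\|^2}{\sigma^{2m}\,m!}+\overline C\,\frac{\|\theta\|^{2k-2}\rho(\theta,\phi)^2}{\sigma^{2k}},$$ where the series on the left converges, and the divergence is finite (with the convention $0^0=1$ in $\|\theta\|^{2k-2}$ when $\theta=0$ and $k=1$). -/

import Mathlib

open MeasureTheory ProbabilityTheory

noncomputable section

namespace OrbitModel

/-- The Borel σ-algebra on the space of square matrices. -/
instance instMeasurableSpaceMatrix (L : ℕ) : MeasurableSpace (Matrix (Fin L) (Fin L) ℝ) :=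
  borel _

instance instBorelSpaceMatrix (L : ℕ) : BorelSpace (Matrix (Fin L) (Fin L) ℝ) :=
  ⟨rfl⟩

variable {L : ℕ}

/-- The action of an orthogonal matrix on `ℝ^L` by left multiplication. -/
def act (g : Matrix.orthogonalGroup (Fin L) ℝ) (θ : EuclideanSpace ℝ (Fin L)) :
    EuclideanSpace ℝ (Fin L) :=
  WithLp.toLp 2 ((g : Matrix (Fin L) (Fin L) ℝ).mulVec θ.ofLp)

lemma continuous_act (θ : EuclideanSpace ℝ (Fin L)) :
    Continuous fun g : Matrix.orthogonalGroup (Fin L) ℝ => act g θ :=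
  (PiLp.continuous_toLp 2 _).comp (continuous_subtype_val.matrix_mulVec continuous_const)

/-- The distance `ρ(θ, φ) = min_{g ∈ G} ‖θ - g φ‖` of `θ` to the orbit of `φ`
(the infimum is attained when `G` is compact). -/
def orbitDist (G : Subgroup (Matrix.orthogonalGroup (Fin L) ℝ))
    (θ φ : EuclideanSpace ℝ (Fin L)) : ℝ :=
  ⨅ g : G, ‖θ - act (g : Matrix.orthogonalGroup (Fin L) ℝ) φ‖

/-- The uniform distribution on a compact group `G` of orthogonal matrices: the Haar measure
of total mass one. -/
def uniformMeasure (G : Subgroup (Matrix.orthogonalGroup (Fin L) ℝ)) [CompactSpace G] :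
    Measure G :=
  Measure.haarMeasure ⊤

instance isProbabilityMeasure_uniformMeasure
    (G : Subgroup (Matrix.orthogonalGroup (Fin L) ℝ)) [CompactSpace G] :
    IsProbabilityMeasure (uniformMeasure G) :=
  ⟨Measure.haarMeasure_self⟩

/-- The expectation `E[g θ]` for `g` uniform on `G`. -/
def meanVector (G : Subgroup (Matrix.orthogonalGroup (Fin L) ℝ)) [CompactSpace G]
    (θ : EuclideanSpace ℝ (Fin L)) : EuclideanSpace ℝ (Fin L) :=
  ∫ g : G, act (g : Matrix.orthogonalGroup (Fin L) ℝ) θ ∂(uniformMeasure G)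

/-- The distribution `P_θ` of `Y = g θ + σ ξ`, where `g` is uniform on `G` and `ξ` is a standard
Gaussian vector independent of `g`. -/
def signalLaw (G : Subgroup (Matrix.orthogonalGroup (Fin L) ℝ)) [CompactSpace G]
    (σ : ℝ) (θ : EuclideanSpace ℝ (Fin L)) : Measure (EuclideanSpace ℝ (Fin L)) :=
  ((uniformMeasure G).prod (stdGaussian (EuclideanSpace ℝ (Fin L)))).map
    fun p => act (p.1 : Matrix.orthogonalGroup (Fin L) ℝ) θ + σ • p.2

lemma measurable_signal (G : Subgroup (Matrix.orthogonalGroup (Fin L) ℝ))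
    (σ : ℝ) (θ : EuclideanSpace ℝ (Fin L)) :
    Measurable fun p : G × EuclideanSpace ℝ (Fin L) =>
      act (p.1 : Matrix.orthogonalGroup (Fin L) ℝ) θ + σ • p.2 :=
  (((continuous_act θ).comp continuous_subtype_val).measurable.comp measurable_fst).add
    (measurable_snd.const_smul σ)

instance isProbabilityMeasure_signalLaw
    (G : Subgroup (Matrix.orthogonalGroup (Fin L) ℝ)) [CompactSpace G]
    (σ : ℝ) (θ : EuclideanSpace ℝ (Fin L)) : IsProbabilityMeasure (signalLaw G σ θ) :=
  Measure.isProbabilityMeasure_map (measurable_signal G σ θ).aemeasurable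

/-- The moment tensor `E[(g θ)^{⊗ m}]` for `g` uniform on `G`, given by its `L^m` entries. The
norm on tensors of order `m` is the Hilbert-Schmidt (entrywise `ℓ²`) norm. -/
def momentTensor (G : Subgroup (Matrix.orthogonalGroup (Fin L) ℝ)) [CompactSpace G]
    (m : ℕ) (θ : EuclideanSpace ℝ (Fin L)) : EuclideanSpace ℝ (Fin m → Fin L) :=
  WithLp.toLp 2 fun i =>
    ∫ g : G, ∏ j, act (g : Matrix.orthogonalGroup (Fin L) ℝ) θ (i j) ∂(uniformMeasure G)

/-- The difference `Δ_m = E[(g θ)^{⊗ m}] - E[(g φ)^{⊗ m}]` of the moment tensors. -/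
def momentDiff (G : Subgroup (Matrix.orthogonalGroup (Fin L) ℝ)) [CompactSpace G]
    (m : ℕ) (θ φ : EuclideanSpace ℝ (Fin L)) : EuclideanSpace ℝ (Fin m → Fin L) :=
  momentTensor G m θ - momentTensor G m φ

end OrbitModel

end

/-!
With respect to the standard Gaussian measure `γ`, and after rescaling to `σ = 1`, the law `P_θ`
has density `p_θ(y) = E exp (⟪g θ, y⟫ - ‖θ‖² / 2)` (`likelihoodRatio`, `signalLaw_one`). Gaussian
integration and the exponential series give
`∫ p_{aθ} p_{bφ} dγ = E exp (a b ⟪g θ, g' φ⟫) = ∑ (a b)^m ⟪E (g θ)^{⊗m}, E (g φ)^{⊗m}⟫ / m!`,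
so that `∫ (p_{aθ} - p_{aφ}) (p_{bθ} - p_{bφ}) dγ = ∑ (a b)^m ‖Δ_m‖² / m!`
(`hasSum_integral_likelihoodDiff_mul`). Both bounds rest on this identity.

*Upper bound.* The integrand `p log (p / q) + q - p` of the divergence is at most
`(p - q)² / (2 min (p, q))` (`mul_klFun_div_le`). As the orbits are centred, Jensen's inequality
bounds `p_θ` and `p_φ` below by `exp (-1)` (`exp_le_likelihoodRatio`), and the divergence is at most
`(e / 2) ∫ (p_θ - p_φ)² dγ ≤ 2 ∑ ‖Δ_m‖² / m!`. The terms of order `m ≥ k` are estimated by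
`‖x^{⊗m} - y^{⊗m}‖ ≤ m M^{m-1} ‖x - y‖` for `x, y` in the ball of radius `M`
(`norm_tensorPow_sub_le`); since moments depend on the orbit only, `‖x - y‖` may be replaced by the
distance between the orbits.

*Lower bound.* The laws are separated by the test function `t = p_{θ/3} - p_{φ/3}`. The difference
of its expectations is `δ = ∑ ‖Δ_m‖² / (3^m m!)`. Moreover `t` is the image under the
Ornstein-Uhlenbeck operator with parameter `1 / √3` of `s = p_{θ/√3} - p_{φ/√3}`, and `∫ s² dγ = δ`
as well. Moving the shift by `g θ` onto the smoothing variable and applying the Cauchy-Schwarz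
inequality gives `∫ t² dP_θ ≤ exp (‖θ‖² / 2) δ` (`lintegral_likelihoodDiff_shift_sq_le`), and
likewise for `P_φ`. Finally `t (p - q) ≤ l t² (p + q) + (√p - √q)² / (2 l)`, and the last square is
at most the integrand of the divergence (`mul_sub_le_add_klFun`); integrating bounds the divergence
below by a multiple of `δ`.
-/

noncomputable section

namespace OrbitModel

/-! ### Scalar inequalities -/

lemma klFun_le_of_one_le {x : ℝ} (hx : 1 ≤ x) :
    InformationTheory.klFun x ≤ (x - 1) ^ 2 / 2 := by
  have hmono : MonotoneOn (fun y : ℝ => (y - 1) ^ 2 / 2 - InformationTheory.klFun y)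
      (Set.Ici 1) := by
    refine monotoneOn_of_deriv_nonneg (convex_Ici 1) ?_ ?_ ?_
    · exact ((by fun_prop : Continuous fun y : ℝ => (y - 1) ^ 2 / 2).sub
        InformationTheory.continuous_klFun).continuousOn
    · intro y hy
      rw [interior_Ici, Set.mem_Ioi] at hy
      exact ((by fun_prop : DifferentiableAt ℝ (fun y : ℝ => (y - 1) ^ 2 / 2) y).sub
        (InformationTheory.hasDerivAt_klFun (by linarith)).differentiableAt).differentiableWithinAt
    · intro y hy
      rw [interior_Ici, Set.mem_Ioi] at hy
      have h1 : HasDerivAt (fun y : ℝ => (y - 1) ^ 2 / 2) (y - 1) y :=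
        ((((hasDerivAt_id' y).sub_const 1).pow 2).div_const 2).congr_deriv (by norm_num)
      have h2 := h1.sub (InformationTheory.hasDerivAt_klFun (x := y) (by linarith))
      have h3 : deriv (fun y : ℝ => (y - 1) ^ 2 / 2 - InformationTheory.klFun y) y
          = (y - 1) - Real.log y := h2.deriv
      rw [h3]
      linarith [Real.log_le_sub_one_of_pos (show 0 < y by linarith)]
  have h := hmono (Set.mem_Ici.2 le_rfl) (Set.mem_Ici.2 hx) hx
  simp only [InformationTheory.klFun_one] at h
  linarith

lemma sub_sq_div_two_le_log {x : ℝ} (hx : 1 ≤ x) : (x - 1) - (x - 1) ^ 2 / 2 ≤ Real.log x := by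
  have hmono : MonotoneOn (fun y : ℝ => Real.log y - ((y - 1) - (y - 1) ^ 2 / 2))
      (Set.Ici 1) := by
    have hd : ∀ y : ℝ, 1 ≤ y →
        HasDerivAt (fun y : ℝ => Real.log y - ((y - 1) - (y - 1) ^ 2 / 2))
          (y⁻¹ - (1 - (y - 1))) y := by
      intro y hy
      have h1 : HasDerivAt (fun y : ℝ => (y - 1) ^ 2 / 2) (y - 1) y :=
        ((((hasDerivAt_id' y).sub_const 1).pow 2).div_const 2).congr_deriv (by norm_num)
      exact (Real.hasDerivAt_log (by linarith)).sub (((hasDerivAt_id y).sub_const 1).sub h1)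
    refine monotoneOn_of_deriv_nonneg (convex_Ici 1)
      (fun y hy => (hd y hy).continuousAt.continuousWithinAt) ?_ ?_
    · intro y hy
      rw [interior_Ici, Set.mem_Ioi] at hy
      exact (hd y hy.le).differentiableAt.differentiableWithinAt
    · intro y hy
      rw [interior_Ici, Set.mem_Ioi] at hy
      rw [(hd y hy.le).deriv]
      have hy0 : 0 < y := by linarith
      have : y⁻¹ - (1 - (y - 1)) = (y - 1) ^ 2 / y := by field_simp; ring
      rw [this]
      positivity
  have h := hmono (Set.mem_Ici.2 le_rfl) (Set.mem_Ici.2 hx) hx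
  simp only [Real.log_one] at h
  linarith

/-- The integrand `q * klFun (p / q) = p log (p / q) + q - p` of the Kullback-Leibler divergence
has second derivative `1 / p` in `p`, so it is at most `(p - q)² / 2` times the largest value of
`1 / s` for `s` between `p` and `q`. -/
lemma mul_klFun_div_le {p q m : ℝ} (hm : 0 < m) (hp : m ≤ p) (hq : m ≤ q) :
    q * InformationTheory.klFun (p / q) ≤ (p - q) ^ 2 / (2 * m) := by
  have hp0 : 0 < p := hm.trans_le hp
  have hq0 : 0 < q := hm.trans_le hq
  rcases le_total q p with h | h
  · have h1 := klFun_le_of_one_le ((one_le_div hq0).2 h)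
    calc q * InformationTheory.klFun (p / q) ≤ q * ((p / q - 1) ^ 2 / 2) := by gcongr
      _ = (p - q) ^ 2 / (2 * q) := by field_simp
      _ ≤ (p - q) ^ 2 / (2 * m) := by gcongr
  · have h1 := sub_sq_div_two_le_log ((one_le_div hp0).2 h)
    have h2 : Real.log (p / q) = - Real.log (q / p) := by
      rw [← Real.log_inv, inv_div]
    calc q * InformationTheory.klFun (p / q) = q - p - p * Real.log (q / p) := by
          rw [InformationTheory.klFun_apply, h2]; field_simp; ring
      _ ≤ q - p - p * ((q / p - 1) - (q / p - 1) ^ 2 / 2) := by gcongr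
      _ = (p - q) ^ 2 / (2 * p) := by field_simp; ring
      _ ≤ (p - q) ^ 2 / (2 * m) := by gcongr

lemma sqrt_sub_sqrt_sq_le_mul_klFun_div {p q : ℝ} (hp : 0 < p) (hq : 0 < q) :
    (√p - √q) ^ 2 ≤ q * InformationTheory.klFun (p / q) := by
  obtain ⟨a, ha, rfl⟩ : ∃ a, 0 < a ∧ p = a ^ 2 := ⟨√p, by positivity, by rw [Real.sq_sqrt hp.le]⟩
  obtain ⟨b, hb, rfl⟩ : ∃ b, 0 < b ∧ q = b ^ 2 := ⟨√q, by positivity, by rw [Real.sq_sqrt hq.le]⟩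
  rw [Real.sqrt_sq ha.le, Real.sqrt_sq hb.le, InformationTheory.klFun_apply]
  have h1 := Real.log_le_sub_one_of_pos (div_pos hb ha)
  have h2 : Real.log (a ^ 2 / b ^ 2) = - (2 * Real.log (b / a)) := by
    rw [← div_pow, Real.log_pow, ← inv_div b a, Real.log_inv]
    push_cast; ring
  rw [h2]
  have h3 : b ^ 2 * (a ^ 2 / b ^ 2 * -(2 * Real.log (b / a)) + 1 - a ^ 2 / b ^ 2)
      = b ^ 2 - a ^ 2 - 2 * a ^ 2 * Real.log (b / a) := by field_simp; ring
  rw [h3]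
  have h4 : a ^ 2 * Real.log (b / a) ≤ a ^ 2 * (b / a - 1) := by gcongr
  have h5 : a ^ 2 * (b / a - 1) = a * b - a ^ 2 := by field_simp
  nlinarith

/-- The variational inequality behind the lower bound: the difference of the expectations of a
test function `t` under two densities is controlled by its second moments and the divergence.
It factors through `p - q = (√p - √q) (√p + √q)` and the arithmetic-geometric mean inequality. -/
lemma mul_sub_le_add_klFun {p q : ℝ} (hp : 0 < p) (hq : 0 < q) (t : ℝ) {l : ℝ} (hl : 0 < l) :
    t * (p - q) ≤ l * (t ^ 2 * p + t ^ 2 * q)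
      + q * InformationTheory.klFun (p / q) / (2 * l) := by
  have h1 := sqrt_sub_sqrt_sq_le_mul_klFun_div hp hq
  have h2 : (√p - √q) ^ 2 / (2 * l) ≤ q * InformationTheory.klFun (p / q) / (2 * l) := by
    gcongr
  refine le_trans ?_ (add_le_add_right h2 _)
  obtain ⟨a, ha, rfl⟩ : ∃ a, 0 < a ∧ p = a ^ 2 := ⟨√p, by positivity, by rw [Real.sq_sqrt hp.le]⟩
  obtain ⟨b, hb, rfl⟩ : ∃ b, 0 < b ∧ q = b ^ 2 := ⟨√q, by positivity, by rw [Real.sq_sqrt hq.le]⟩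
  rw [Real.sqrt_sq ha.le, Real.sqrt_sq hb.le]
  have h3 : 0 ≤ (l * t * (a + b) - (a - b)) ^ 2 / (2 * l) + l * t ^ 2 * (a - b) ^ 2 / 2 := by
    positivity
  have h4 : l * (t ^ 2 * a ^ 2 + t ^ 2 * b ^ 2) + (a - b) ^ 2 / (2 * l) - t * (a ^ 2 - b ^ 2)
      = (l * t * (a + b) - (a - b)) ^ 2 / (2 * l) + l * t ^ 2 * (a - b) ^ 2 / 2 := by
    field_simp; ring
  linarith

/-! ### Divergence between measures given by densities -/

lemma klDiv_withDensity {α : Type*} [MeasurableSpace α] {γ : Measure α} [IsFiniteMeasure γ]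
    {p q : α → ℝ} (hp : Measurable p) (hq : Measurable q) (hp0 : ∀ x, 0 ≤ p x)
    (hq0 : ∀ x, 0 < q x)
    [IsFiniteMeasure (γ.withDensity fun x => ENNReal.ofReal (p x))]
    [IsFiniteMeasure (γ.withDensity fun x => ENNReal.ofReal (q x))] :
    InformationTheory.klDiv (γ.withDensity fun x => ENNReal.ofReal (p x))
      (γ.withDensity fun x => ENNReal.ofReal (q x))
      = ∫⁻ x, ENNReal.ofReal (q x * InformationTheory.klFun (p x / q x)) ∂γ := by
  have hpm : Measurable fun x => ENNReal.ofReal (p x) := hp.ennreal_ofReal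
  have hqm : Measurable fun x => ENNReal.ofReal (q x) := hq.ennreal_ofReal
  have hq_ne : ∀ᵐ x ∂γ, ENNReal.ofReal (q x) ≠ 0 := by
    filter_upwards with x
    simpa using hq0 x
  have hγ : γ ≪ γ.withDensity fun x => ENNReal.ofReal (q x) :=
    withDensity_absolutelyContinuous' hqm.aemeasurable hq_ne
  have hac := (withDensity_absolutelyContinuous γ fun x => ENNReal.ofReal (p x)).trans hγ
  rw [InformationTheory.klDiv_eq_lintegral_klFun_of_ac hac,
    lintegral_withDensity_eq_lintegral_mul _ hqm (by fun_prop)]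
  refine lintegral_congr_ae ?_
  filter_upwards [Measure.rnDeriv_withDensity_right (γ.withDensity fun x => ENNReal.ofReal (p x)) γ
    hqm.aemeasurable hq_ne (by simp), Measure.rnDeriv_withDensity γ hpm] with x h1 h2
  rw [Pi.mul_apply, h1, h2, ENNReal.toReal_mul, ENNReal.toReal_inv,
    ENNReal.toReal_ofReal (hq0 x).le, ENNReal.toReal_ofReal (hp0 x),
    ENNReal.ofReal_mul (hq0 x).le, div_eq_inv_mul]

lemma klDiv_map_eq_of_leftInverse {α β : Type*} [MeasurableSpace α] [MeasurableSpace β]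
    (μ ν : Measure α) [IsFiniteMeasure μ] [IsFiniteMeasure ν] {f : α → β} {g : β → α}
    (hf : Measurable f) (hg : Measurable g) (h : Function.LeftInverse g f) :
    InformationTheory.klDiv (μ.map f) (ν.map f) = InformationTheory.klDiv μ ν := by
  refine le_antisymm (InformationTheory.klDiv_map_le _ _ hf) ?_
  have := InformationTheory.klDiv_map_le (μ.map f) (ν.map f) hg
  rwa [Measure.map_map hg hf, Measure.map_map hg hf, h.comp_eq_id, Measure.map_id,
    Measure.map_id] at this

/-! ### Exponential integrals against the standard Gaussian measure -/

variable {L : ℕ}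

/-- The Laplace transform of the standard Gaussian measure at a complex vector `z`. -/
lemma integral_cexp_sum_stdGaussian (z : Fin L → ℂ) :
    ∫ y, Complex.exp (∑ i, z i * (y i : ℂ)) ∂(stdGaussian (EuclideanSpace ℝ (Fin L)))
      = Complex.exp (∑ i, z i ^ 2 / 2) := by
  rw [← map_pi_eq_stdGaussian, integral_map (by fun_prop)
    (Measurable.aestronglyMeasurable (by fun_prop))]
  simp_rw [Complex.exp_sum]
  rw [integral_fintype_prod_eq_prod (f := fun i (x : ℝ) => Complex.exp (z i * (x : ℂ)))]
  refine Finset.prod_congr rfl fun i _ => ?_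
  have := complexMGF_gaussianReal (p := gaussianReal 0 1) (X := id) (μ := 0) (v := 1)
    (by simp) (z i)
  simpa [complexMGF] using this

lemma integral_exp_inner_stdGaussian (a : EuclideanSpace ℝ (Fin L)) :
    ∫ y, Real.exp (inner ℝ a y) ∂(stdGaussian (EuclideanSpace ℝ (Fin L)))
      = Real.exp (‖a‖ ^ 2 / 2) := by
  have h := integral_cexp_sum_stdGaussian (fun i => (a i : ℂ))
  have h1 : ∀ y : EuclideanSpace ℝ (Fin L), Complex.exp (∑ i, (a i : ℂ) * (y i : ℂ))
      = ((Real.exp (inner ℝ a y) : ℝ) : ℂ) := by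
    intro y
    rw [PiLp.inner_apply]
    push_cast
    congr 1
    refine Finset.sum_congr rfl fun i _ => ?_
    simp [mul_comm]
  simp_rw [h1] at h
  rw [integral_complex_ofReal] at h
  have h2 : Complex.exp (∑ i, (a i : ℂ) ^ 2 / 2) = ((Real.exp (‖a‖ ^ 2 / 2) : ℝ) : ℂ) := by
    rw [EuclideanSpace.real_norm_sq_eq, Finset.sum_div]
    push_cast
    rfl
  rw [h2] at h
  exact_mod_cast h

lemma integrable_exp_inner_stdGaussian (a : EuclideanSpace ℝ (Fin L)) :
    Integrable (fun y => Real.exp (inner ℝ a y))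
      (stdGaussian (EuclideanSpace ℝ (Fin L))) :=
  .of_integral_ne_zero (by rw [integral_exp_inner_stdGaussian]; positivity)

/-- The Cameron-Martin formula: the density of a shifted standard Gaussian measure. -/
lemma stdGaussian_map_add (x : EuclideanSpace ℝ (Fin L)) :
    (stdGaussian (EuclideanSpace ℝ (Fin L))).map (fun y => x + y)
      = (stdGaussian (EuclideanSpace ℝ (Fin L))).withDensity
          fun y => ENNReal.ofReal (Real.exp (inner ℝ x y - ‖x‖ ^ 2 / 2)) := by
  have hint : Integrable (fun y => Real.exp (inner ℝ x y - ‖x‖ ^ 2 / 2))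
      (stdGaussian (EuclideanSpace ℝ (Fin L))) := by
    simp_rw [Real.exp_sub]
    exact (integrable_exp_inner_stdGaussian x).div_const _
  have := isFiniteMeasure_withDensity_ofReal hint.2
  have : IsFiniteMeasure ((stdGaussian (EuclideanSpace ℝ (Fin L))).map (fun y => x + y)) :=
    inferInstance
  refine Measure.ext_of_charFun ?_
  ext t
  have hs : ∀ u v : EuclideanSpace ℝ (Fin L), ((inner ℝ u v : ℝ) : ℂ) = ∑ i, (u i : ℂ) * v i := by
    intro u v
    rw [PiLp.inner_apply]
    push_cast
    refine Finset.sum_congr rfl fun i _ => ?_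
    simp [mul_comm]
  rw [charFun_apply, charFun_apply, integral_map (by fun_prop)
    (Measurable.aestronglyMeasurable (by fun_prop)),
    integral_withDensity_eq_integral_toReal_smul (by fun_prop) (by simp)]
  have hl : ∀ y : EuclideanSpace ℝ (Fin L), Complex.exp ((inner ℝ (x + y) t : ℝ) * Complex.I)
      = Complex.exp ((inner ℝ x t : ℝ) * Complex.I)
        * Complex.exp (∑ i, (t i * Complex.I) * (y i : ℂ)) := by
    intro y
    rw [← Complex.exp_add, inner_add_left, Complex.ofReal_add, add_mul, hs y t, Finset.sum_mul]
    congr 2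
    exact Finset.sum_congr rfl fun i _ => by ring
  have hr : ∀ y : EuclideanSpace ℝ (Fin L),
      (ENNReal.ofReal (Real.exp (inner ℝ x y - ‖x‖ ^ 2 / 2))).toReal •
        Complex.exp ((inner ℝ y t : ℝ) * Complex.I)
      = Complex.exp (-((‖x‖ ^ 2 / 2 : ℝ) : ℂ))
        * Complex.exp (∑ i, (x i + t i * Complex.I) * (y i : ℂ)) := by
    intro y
    rw [ENNReal.toReal_ofReal (by positivity), Complex.real_smul, Complex.ofReal_exp,
      ← Complex.exp_add, ← Complex.exp_add, Complex.ofReal_sub, hs x y, hs y t, Finset.sum_mul]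
    simp_rw [add_mul, Finset.sum_add_distrib]
    rw [show ∑ i, (y i : ℂ) * t i * Complex.I = ∑ i, (t i : ℂ) * Complex.I * y i from
      Finset.sum_congr rfl fun i _ => by ring]
    congr 1
    ring
  simp_rw [hl, hr]
  rw [integral_const_mul, integral_const_mul, integral_cexp_sum_stdGaussian,
    integral_cexp_sum_stdGaussian, ← Complex.exp_add, ← Complex.exp_add, hs,
    EuclideanSpace.real_norm_sq_eq]
  congr 1
  push_cast
  rw [Finset.sum_mul, Finset.sum_div, ← Finset.sum_add_distrib, ← Finset.sum_neg_distrib,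
    ← Finset.sum_add_distrib]
  refine Finset.sum_congr rfl fun i _ => ?_
  ring_nf

/-- Rotation invariance of the standard Gaussian measure, for a plane rotation of two
independent copies. -/
lemma stdGaussian_prod_map_add {a b : ℝ} (hab : a ^ 2 + b ^ 2 = 1) :
    ((stdGaussian (EuclideanSpace ℝ (Fin L))).prod
      (stdGaussian (EuclideanSpace ℝ (Fin L)))).map (fun p => a • p.1 + b • p.2)
      = stdGaussian (EuclideanSpace ℝ (Fin L)) := by
  refine Measure.ext_of_charFun ?_
  ext t
  rw [charFun_apply, integral_map (by fun_prop) (Measurable.aestronglyMeasurable (by fun_prop))]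
  have h : ∀ p : EuclideanSpace ℝ (Fin L) × EuclideanSpace ℝ (Fin L),
      Complex.exp ((inner ℝ (a • p.1 + b • p.2) t : ℝ) * Complex.I)
      = Complex.exp ((inner ℝ p.1 (a • t) : ℝ) * Complex.I)
        * Complex.exp ((inner ℝ p.2 (b • t) : ℝ) * Complex.I) := by
    intro p
    rw [← Complex.exp_add, inner_add_left, inner_smul_left, inner_smul_left, inner_smul_right,
      inner_smul_right]
    congr 1
    push_cast
    simp [add_mul]
  simp_rw [h]
  rw [integral_prod_mul (fun x : EuclideanSpace ℝ (Fin L) =>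
    Complex.exp ((inner ℝ x (a • t) : ℝ) * Complex.I)) (fun x : EuclideanSpace ℝ (Fin L) =>
    Complex.exp ((inner ℝ x (b • t) : ℝ) * Complex.I)), ← charFun_apply, ← charFun_apply,
    charFun_stdGaussian, charFun_stdGaussian, charFun_stdGaussian, ← Complex.exp_add]
  congr 1
  rw [norm_smul, norm_smul]
  have : (‖t‖ : ℂ) ^ 2 = ((a ^ 2 + b ^ 2 : ℝ) : ℂ) * (‖t‖ : ℂ) ^ 2 := by rw [hab]; simp
  rw [this]
  have ha : ((‖a‖ : ℝ) : ℂ) ^ 2 = (a : ℂ) ^ 2 := by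
    rw [← Complex.ofReal_pow, Real.norm_eq_abs, sq_abs, Complex.ofReal_pow]
  have hb : ((‖b‖ : ℝ) : ℂ) ^ 2 = (b : ℂ) ^ 2 := by
    rw [← Complex.ofReal_pow, Real.norm_eq_abs, sq_abs, Complex.ofReal_pow]
  push_cast
  rw [mul_pow, mul_pow, ha, hb]
  ring

/-! ### The orthogonal action and its uniform measure -/

instance instSecondCountableTopologyMatrix (L : ℕ) :
    SecondCountableTopology (Matrix (Fin L) (Fin L) ℝ) :=
  inferInstanceAs (SecondCountableTopology (Fin L → Fin L → ℝ))

instance instSecondCountableTopologySubgroup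
    (G : Subgroup (Matrix.orthogonalGroup (Fin L) ℝ)) : SecondCountableTopology G :=
  (Topology.IsInducing.subtypeVal.comp Topology.IsInducing.subtypeVal).secondCountableTopology

lemma act_smul (g : Matrix.orthogonalGroup (Fin L) ℝ) (c : ℝ) (θ : EuclideanSpace ℝ (Fin L)) :
    act g (c • θ) = c • act g θ := by
  simp [act, Matrix.mulVec_smul]

lemma act_sub (g : Matrix.orthogonalGroup (Fin L) ℝ) (θ φ : EuclideanSpace ℝ (Fin L)) :
    act g (θ - φ) = act g θ - act g φ := by
  simp [act, Matrix.mulVec_sub]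

lemma act_mul (g h : Matrix.orthogonalGroup (Fin L) ℝ) (θ : EuclideanSpace ℝ (Fin L)) :
    act (g * h) θ = act g (act h θ) := by
  simp [act, Matrix.mulVec_mulVec]

lemma norm_act (g : Matrix.orthogonalGroup (Fin L) ℝ) (θ : EuclideanSpace ℝ (Fin L)) :
    ‖act g θ‖ = ‖θ‖ := by
  have hg : (g : Matrix (Fin L) (Fin L) ℝ).transpose * (g : Matrix (Fin L) (Fin L) ℝ) = 1 :=
    (Matrix.mem_orthogonalGroup_iff' (Fin L) ℝ).1 g.2
  have h : ‖act g θ‖ ^ 2 = ‖θ‖ ^ 2 := by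
    rw [← real_inner_self_eq_norm_sq, ← real_inner_self_eq_norm_sq,
      EuclideanSpace.inner_eq_star_dotProduct, EuclideanSpace.inner_eq_star_dotProduct]
    simp only [act, star_trivial]
    rw [Matrix.dotProduct_mulVec, ← Matrix.mulVec_transpose, Matrix.mulVec_mulVec, hg,
      Matrix.one_mulVec]
  exact (pow_left_inj₀ (norm_nonneg _) (norm_nonneg _) two_ne_zero).1 h

lemma continuous_act_subgroup (G : Subgroup (Matrix.orthogonalGroup (Fin L) ℝ))
    (θ : EuclideanSpace ℝ (Fin L)) :
    Continuous fun g : G => act (g : Matrix.orthogonalGroup (Fin L) ℝ) θ :=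
  (continuous_act θ).comp continuous_subtype_val

lemma continuous_act_fst (G : Subgroup (Matrix.orthogonalGroup (Fin L) ℝ))
    (θ : EuclideanSpace ℝ (Fin L)) :
    Continuous fun p : G × G => act (p.1 : Matrix.orthogonalGroup (Fin L) ℝ) θ :=
  (continuous_act_subgroup G θ).comp continuous_fst

lemma continuous_act_snd (G : Subgroup (Matrix.orthogonalGroup (Fin L) ℝ))
    (φ : EuclideanSpace ℝ (Fin L)) :
    Continuous fun p : G × G => act (p.2 : Matrix.orthogonalGroup (Fin L) ℝ) φ :=
  (continuous_act_subgroup G φ).comp continuous_snd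

lemma integrable_of_continuous_of_compactSpace {Ω F : Type*} [TopologicalSpace Ω] [CompactSpace Ω]
    [MeasurableSpace Ω] [OpensMeasurableSpace Ω] [SecondCountableTopology Ω]
    [NormedAddCommGroup F] (ν : Measure Ω) [IsFiniteMeasure ν] {f : Ω → F} (hf : Continuous f) :
    Integrable f ν := by
  have : IsFiniteMeasureOnCompacts ν := ⟨fun _ _ => measure_lt_top _ _⟩
  rw [← integrableOn_univ]
  exact hf.continuousOn.integrableOn_compact' isCompact_univ MeasurableSet.univ

lemma orbitDist_smul (G : Subgroup (Matrix.orthogonalGroup (Fin L) ℝ))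
    {c : ℝ} (hc : 0 ≤ c)
    (θ φ : EuclideanSpace ℝ (Fin L)) :
    orbitDist G (c • θ) (c • φ) = c * orbitDist G θ φ := by
  simp_rw [orbitDist, act_smul, ← smul_sub, norm_smul, Real.norm_of_nonneg hc]
  rw [Real.mul_iInf_of_nonneg hc]

variable (G : Subgroup (Matrix.orthogonalGroup (Fin L) ℝ)) [CompactSpace G]

instance isHaarMeasure_uniformMeasure : (uniformMeasure G).IsHaarMeasure :=
  Measure.isHaarMeasure_haarMeasure _

/-- A compact group is unimodular: the translates of the uniform measure from the right are
left-invariant probability measures, hence equal to it. -/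
instance isMulRightInvariant_uniformMeasure : (uniformMeasure G).IsMulRightInvariant := by
  refine ⟨fun h => ?_⟩
  have : IsProbabilityMeasure ((uniformMeasure G).map (· * h)) :=
    Measure.isProbabilityMeasure_map (measurable_mul_const h).aemeasurable
  have : ((uniformMeasure G).map (· * h)).IsHaarMeasure := inferInstance
  exact Measure.isHaarMeasure_eq_of_isProbabilityMeasure _ _

/-! ### Tensor powers and moment tensors -/

/-- The tensor power `x^{⊗ m}`, given by its `L^m` entries. -/
def tensorPow (m : ℕ) (x : EuclideanSpace ℝ (Fin L)) : EuclideanSpace ℝ (Fin m → Fin L) :=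
  WithLp.toLp 2 fun i => ∏ j, x (i j)

lemma continuous_tensorPow (m : ℕ) : Continuous (tensorPow (L := L) m) := by
  unfold tensorPow
  fun_prop

lemma inner_tensorPow (m : ℕ) (x y : EuclideanSpace ℝ (Fin L)) :
    inner ℝ (tensorPow m x) (tensorPow m y) = inner ℝ x y ^ m := by
  rw [PiLp.inner_apply, PiLp.inner_apply, Finset.sum_pow', Fintype.piFinset_univ]
  refine Finset.sum_congr rfl fun i _ => ?_
  simp [tensorPow, Finset.prod_mul_distrib]

lemma norm_tensorPow_sub_le (m : ℕ) {x y : EuclideanSpace ℝ (Fin L)} {M : ℝ}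
    (hx : ‖x‖ ≤ M) (hy : ‖y‖ ≤ M) :
    ‖tensorPow m x - tensorPow m y‖ ≤ m * M ^ (m - 1) * ‖x - y‖ := by
  have hM : 0 ≤ M := (norm_nonneg x).trans hx
  have key : ‖tensorPow m x - tensorPow m y‖ ^ 2 ≤ (m * M ^ (m - 1) * ‖x - y‖) ^ 2 := by
    rcases m with _ | n
    · simp [tensorPow]
    have e : ∀ z : EuclideanSpace ℝ (Fin L), ‖tensorPow (n + 1) z‖ ^ 2 = (‖z‖ ^ 2) ^ (n + 1) := by
      intro z
      rw [← real_inner_self_eq_norm_sq, inner_tensorPow, real_inner_self_eq_norm_sq]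
    rw [norm_sub_sq_real, e, e, inner_tensorPow, Nat.add_sub_cancel, mul_pow _ ‖x - y‖,
      norm_sub_sq_real]
    set c := inner ℝ x y
    set A : ℝ := ((n + 1 : ℕ) : ℝ)
    have hA : 1 ≤ A := by simp [A]
    have hc : |c| ≤ ‖x‖ * ‖y‖ := abs_real_inner_le_norm x y
    have hxy : ‖x‖ * ‖y‖ ≤ M ^ 2 := by rw [sq]; gcongr
    -- The squared distance is `(‖x‖ - ‖y‖)² + 2 (‖x‖ ‖y‖ - ⟪x, y⟫)`, and likewise for the powers.
    have h1 : (‖x‖ ^ (n + 1) - ‖y‖ ^ (n + 1)) ^ 2 ≤ (A * M ^ n) ^ 2 * (‖x‖ - ‖y‖) ^ 2 := by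
      rw [← mul_pow]
      refine sq_le_sq.2 ?_
      calc |‖x‖ ^ (n + 1) - ‖y‖ ^ (n + 1)|
          ≤ |‖x‖ - ‖y‖| * A * max |‖x‖| |‖y‖| ^ (n + 1 - 1) := abs_pow_sub_pow_le ..
        _ ≤ |‖x‖ - ‖y‖| * A * M ^ n := by
          rw [abs_norm, abs_norm, Nat.add_sub_cancel]
          gcongr
          exact max_le hx hy
        _ = |A * M ^ n * (‖x‖ - ‖y‖)| := by
          rw [abs_mul, abs_of_nonneg (show 0 ≤ A * M ^ n by positivity)]; ring
    have h2 : (‖x‖ * ‖y‖) ^ (n + 1) - c ^ (n + 1) ≤ (A * M ^ n) ^ 2 * (‖x‖ * ‖y‖ - c) := by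
      have h0 : 0 ≤ ‖x‖ * ‖y‖ - c := by linarith [le_abs_self c]
      calc (‖x‖ * ‖y‖) ^ (n + 1) - c ^ (n + 1)
          ≤ |(‖x‖ * ‖y‖) ^ (n + 1) - c ^ (n + 1)| := le_abs_self _
        _ ≤ |‖x‖ * ‖y‖ - c| * A * max |‖x‖ * ‖y‖| |c| ^ (n + 1 - 1) := abs_pow_sub_pow_le ..
        _ ≤ (‖x‖ * ‖y‖ - c) * A * (M ^ 2) ^ n := by
          rw [abs_of_nonneg h0, Nat.add_sub_cancel]
          gcongr
          refine max_le ?_ (hc.trans hxy)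
          rwa [abs_of_nonneg (by positivity)]
        _ = A * ((M ^ n) ^ 2 * (‖x‖ * ‖y‖ - c)) := by ring
        _ ≤ A ^ 2 * ((M ^ n) ^ 2 * (‖x‖ * ‖y‖ - c)) := by
          gcongr
          nlinarith
        _ = (A * M ^ n) ^ 2 * (‖x‖ * ‖y‖ - c) := by ring
    calc (‖x‖ ^ 2) ^ (n + 1) - 2 * c ^ (n + 1) + (‖y‖ ^ 2) ^ (n + 1)
        = (‖x‖ ^ (n + 1) - ‖y‖ ^ (n + 1)) ^ 2 + 2 * ((‖x‖ * ‖y‖) ^ (n + 1) - c ^ (n + 1)) := by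
          ring
      _ ≤ (A * M ^ n) ^ 2 * (‖x‖ - ‖y‖) ^ 2 + 2 * ((A * M ^ n) ^ 2 * (‖x‖ * ‖y‖ - c)) := by
          gcongr
      _ = (A * M ^ n) ^ 2 * (‖x‖ ^ 2 - 2 * c + ‖y‖ ^ 2) := by ring
  exact (sq_le_sq₀ (norm_nonneg _) (by positivity)).1 key

lemma integrable_tensorPow_act (m : ℕ) (θ : EuclideanSpace ℝ (Fin L)) :
    Integrable (fun g : G => tensorPow m (act (g : Matrix.orthogonalGroup (Fin L) ℝ) θ))
      (uniformMeasure G) :=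
  integrable_of_continuous_of_compactSpace _
    ((continuous_tensorPow m).comp (continuous_act_subgroup G θ))

lemma momentTensor_eq_integral (m : ℕ) (θ : EuclideanSpace ℝ (Fin L)) :
    momentTensor G m θ = ∫ g : G, tensorPow m (act (g : Matrix.orthogonalGroup (Fin L) ℝ) θ)
      ∂(uniformMeasure G) := by
  ext i
  have := (EuclideanSpace.proj (𝕜 := ℝ) i).integral_comp_comm
    (integrable_tensorPow_act G m θ)
  exact this

lemma momentTensor_smul (m : ℕ) (c : ℝ) (θ : EuclideanSpace ℝ (Fin L)) :
    momentTensor G m (c • θ) = c ^ m • momentTensor G m θ := by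
  ext i
  simp [momentTensor, act_smul, Finset.prod_mul_distrib, integral_const_mul]

lemma momentDiff_smul (m : ℕ) (c : ℝ) (θ φ : EuclideanSpace ℝ (Fin L)) :
    momentDiff G m (c • θ) (c • φ) = c ^ m • momentDiff G m θ φ := by
  rw [momentDiff, momentDiff, momentTensor_smul, momentTensor_smul, smul_sub]

lemma momentDiff_zero (θ φ : EuclideanSpace ℝ (Fin L)) : momentDiff G 0 θ φ = 0 := by
  ext i
  simp [momentDiff, momentTensor]

lemma momentTensor_act (m : ℕ) (h : G) (θ : EuclideanSpace ℝ (Fin L)) :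
    momentTensor G m (act (h : Matrix.orthogonalGroup (Fin L) ℝ) θ) = momentTensor G m θ := by
  rw [momentTensor_eq_integral, momentTensor_eq_integral, ← integral_mul_right_eq_self
    (fun g : G => tensorPow m (act (g : Matrix.orthogonalGroup (Fin L) ℝ) θ)) h]
  simp [act_mul]

lemma inner_momentTensor (m : ℕ) (θ φ : EuclideanSpace ℝ (Fin L)) :
    inner ℝ (momentTensor G m θ) (momentTensor G m φ)
      = ∫ p : G × G, inner ℝ (act (p.1 : Matrix.orthogonalGroup (Fin L) ℝ) θ)
          (act (p.2 : Matrix.orthogonalGroup (Fin L) ℝ) φ) ^ m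
          ∂((uniformMeasure G).prod (uniformMeasure G)) := by
  have hc : Continuous fun p : G × G =>
      inner ℝ (tensorPow m (act (p.1 : Matrix.orthogonalGroup (Fin L) ℝ) θ))
        (tensorPow m (act (p.2 : Matrix.orthogonalGroup (Fin L) ℝ) φ)) :=
    (((continuous_tensorPow m).comp (continuous_act_subgroup G θ)).comp continuous_fst).inner
      (((continuous_tensorPow m).comp (continuous_act_subgroup G φ)).comp continuous_snd)
  simp_rw [← inner_tensorPow]
  rw [integral_prod _ (integrable_of_continuous_of_compactSpace _ hc)]
  simp_rw [integral_inner (integrable_tensorPow_act G m φ)]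
  rw [← momentTensor_eq_integral]
  simp_rw [real_inner_comm (momentTensor G m φ)]
  rw [integral_inner (integrable_tensorPow_act G m θ), ← momentTensor_eq_integral, real_inner_comm]

lemma exists_orbitDist_eq (θ φ : EuclideanSpace ℝ (Fin L)) :
    ∃ h : G, orbitDist G θ φ = ‖θ - act (h : Matrix.orthogonalGroup (Fin L) ℝ) φ‖ := by
  obtain ⟨h, -, hh⟩ := isCompact_univ.exists_isMinOn (Set.univ_nonempty (α := G))
    (continuous_const.sub (continuous_act_subgroup G φ)).norm.continuousOn (f := fun g : G =>
      ‖θ - act (g : Matrix.orthogonalGroup (Fin L) ℝ) φ‖)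
  refine ⟨h, le_antisymm (ciInf_le ⟨0, ?_⟩ h) (le_ciInf fun g => hh (Set.mem_univ g))⟩
  rintro _ ⟨g, rfl⟩
  exact norm_nonneg _

lemma norm_le_add_orbitDist (θ φ : EuclideanSpace ℝ (Fin L)) :
    ‖φ‖ ≤ ‖θ‖ + orbitDist G θ φ := by
  obtain ⟨h, hh⟩ := exists_orbitDist_eq G θ φ
  rw [hh, ← norm_act h φ]
  exact norm_le_norm_add_norm_sub θ _

lemma orbitDist_nonneg (θ φ : EuclideanSpace ℝ (Fin L)) : 0 ≤ orbitDist G θ φ := by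
  obtain ⟨h, hh⟩ := exists_orbitDist_eq G θ φ
  rw [hh]
  positivity

lemma norm_momentDiff_le (m : ℕ) {θ φ : EuclideanSpace ℝ (Fin L)} {M : ℝ}
    (hθ : ‖θ‖ ≤ M) (hφ : ‖φ‖ ≤ M) :
    ‖momentDiff G m θ φ‖ ≤ m * M ^ (m - 1) * orbitDist G θ φ := by
  obtain ⟨h, hh⟩ := exists_orbitDist_eq G θ φ
  rw [momentDiff, ← momentTensor_act G m h φ, momentTensor_eq_integral, momentTensor_eq_integral,
    ← integral_sub (integrable_tensorPow_act G m _) (integrable_tensorPow_act G m _)]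
  refine (norm_integral_le_of_norm_le_const (C := m * M ^ (m - 1) * orbitDist G θ φ)
    (Filter.Eventually.of_forall fun g => ?_)).trans (by simp)
  refine (norm_tensorPow_sub_le (M := M) m ?_ ?_).trans ?_
  · rwa [norm_act]
  · rwa [norm_act, norm_act]
  · rw [← act_sub, norm_act, hh]

/-! ### Mixtures of exponentials -/

section Mixture

variable {Ω : Type*} [TopologicalSpace Ω] [CompactSpace Ω] [MeasurableSpace Ω]
  [OpensMeasurableSpace Ω] [SecondCountableTopology Ω] (ν : Measure Ω) [IsFiniteMeasure ν]
  {a : Ω → EuclideanSpace ℝ (Fin L)} {c : Ω → ℝ}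

lemma integrable_exp_add_inner_prod (ha : Continuous a) (hc : Continuous c) :
    Integrable (fun p : Ω × EuclideanSpace ℝ (Fin L) => Real.exp (c p.1 + inner ℝ (a p.1) p.2))
      (ν.prod (stdGaussian (EuclideanSpace ℝ (Fin L)))) := by
  have hcont : Continuous fun p : Ω × EuclideanSpace ℝ (Fin L) =>
      Real.exp (c p.1 + inner ℝ (a p.1) p.2) := by fun_prop
  rw [integrable_prod_iff hcont.aestronglyMeasurable]
  simp_rw [Real.norm_of_nonneg (Real.exp_pos _).le, Real.exp_add]
  refine ⟨Filter.Eventually.of_forall fun ω =>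
    (integrable_exp_inner_stdGaussian (a ω)).const_mul _, ?_⟩
  simp_rw [integral_const_mul, integral_exp_inner_stdGaussian]
  exact integrable_of_continuous_of_compactSpace ν (by fun_prop)

lemma integrable_integral_exp_add_inner (ha : Continuous a) (hc : Continuous c) :
    Integrable (fun y => ∫ ω, Real.exp (c ω + inner ℝ (a ω) y) ∂ν)
      (stdGaussian (EuclideanSpace ℝ (Fin L))) :=
  (integrable_exp_add_inner_prod ν ha hc).integral_prod_right

lemma integral_integral_exp_add_inner (ha : Continuous a) (hc : Continuous c) :
    ∫ y, ∫ ω, Real.exp (c ω + inner ℝ (a ω) y) ∂ν ∂(stdGaussian (EuclideanSpace ℝ (Fin L)))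
      = ∫ ω, Real.exp (c ω + ‖a ω‖ ^ 2 / 2) ∂ν := by
  rw [← integral_integral_swap (f := fun ω y => Real.exp (c ω + inner ℝ (a ω) y))
    (integrable_exp_add_inner_prod ν ha hc)]
  simp_rw [Real.exp_add, integral_const_mul, integral_exp_inner_stdGaussian]

end Mixture

/-! ### The likelihood ratio of the orbit model -/

/-- The likelihood ratio `y ↦ E[exp(⟪g θ, y⟫ - ‖θ‖² / 2)]`: the density, with respect to the
standard Gaussian measure, of the law of `g θ + ξ` (noise level one). -/
def likelihoodRatio (θ y : EuclideanSpace ℝ (Fin L)) : ℝ :=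
  ∫ g : G, Real.exp (-‖θ‖ ^ 2 / 2 + inner ℝ (act (g : Matrix.orthogonalGroup (Fin L) ℝ) θ) y)
    ∂(uniformMeasure G)

lemma integrable_exp_inner_act (θ y : EuclideanSpace ℝ (Fin L)) :
    Integrable (fun g : G => Real.exp (-‖θ‖ ^ 2 / 2
      + inner ℝ (act (g : Matrix.orthogonalGroup (Fin L) ℝ) θ) y)) (uniformMeasure G) := by
  have := continuous_act_subgroup G θ
  exact integrable_of_continuous_of_compactSpace _ (by fun_prop)

lemma likelihoodRatio_pos (θ y : EuclideanSpace ℝ (Fin L)) : 0 < likelihoodRatio G θ y :=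
  integral_exp_pos (integrable_exp_inner_act G θ y)

lemma measurable_likelihoodRatio (θ : EuclideanSpace ℝ (Fin L)) :
    Measurable (likelihoodRatio G θ) := by
  have := (continuous_act_subgroup G θ).comp
    (continuous_snd (X := EuclideanSpace ℝ (Fin L)) (Y := G))
  simp only [Function.comp_def] at this
  have hcont : Continuous fun p : EuclideanSpace ℝ (Fin L) × G => Real.exp (-‖θ‖ ^ 2 / 2
      + inner ℝ (act (p.2 : Matrix.orthogonalGroup (Fin L) ℝ) θ) p.1) := by fun_prop
  exact hcont.stronglyMeasurable.integral_prod_right.measurable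

/-- By Jensen's inequality (here `1 + x ≤ exp x`), a centred orbit has likelihood ratio bounded
below. -/
lemma exp_le_likelihoodRatio {θ : EuclideanSpace ℝ (Fin L)} (hθ : meanVector G θ = 0)
    (y : EuclideanSpace ℝ (Fin L)) : Real.exp (-‖θ‖ ^ 2 / 2) ≤ likelihoodRatio G θ y := by
  have hc := continuous_act_subgroup G θ
  have hi : Integrable (fun g : G => inner ℝ y (act (g : Matrix.orthogonalGroup (Fin L) ℝ) θ))
      (uniformMeasure G) := integrable_of_continuous_of_compactSpace _ (by fun_prop)
  have h1 : ∫ g : G, (1 + inner ℝ y (act (g : Matrix.orthogonalGroup (Fin L) ℝ) θ))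
      ∂(uniformMeasure G) = 1 := by
    rw [integral_add (integrable_const _) hi, integral_inner
      (integrable_of_continuous_of_compactSpace _ hc), ← meanVector, hθ]
    simp
  calc Real.exp (-‖θ‖ ^ 2 / 2)
      = Real.exp (-‖θ‖ ^ 2 / 2)
        * ∫ g : G, (1 + inner ℝ y (act (g : Matrix.orthogonalGroup (Fin L) ℝ) θ))
          ∂(uniformMeasure G) := by rw [h1, mul_one]
    _ = ∫ g : G, Real.exp (-‖θ‖ ^ 2 / 2)
        * (1 + inner ℝ y (act (g : Matrix.orthogonalGroup (Fin L) ℝ) θ))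
          ∂(uniformMeasure G) := by rw [integral_const_mul]
    _ ≤ likelihoodRatio G θ y := by
      refine integral_mono (((integrable_const _).add hi).const_mul _)
        (integrable_exp_inner_act G θ y) fun g => ?_
      simp only
      rw [Real.exp_add, real_inner_comm, add_comm]
      gcongr
      exact Real.add_one_le_exp _

lemma likelihoodRatio_mul (θ φ y : EuclideanSpace ℝ (Fin L)) :
    likelihoodRatio G θ y * likelihoodRatio G φ y
      = ∫ p : G × G, Real.exp ((-‖θ‖ ^ 2 / 2 + -‖φ‖ ^ 2 / 2)
          + inner ℝ (act (p.1 : Matrix.orthogonalGroup (Fin L) ℝ) θ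
            + act (p.2 : Matrix.orthogonalGroup (Fin L) ℝ) φ) y)
          ∂((uniformMeasure G).prod (uniformMeasure G)) := by
  rw [likelihoodRatio, likelihoodRatio, ← integral_prod_mul]
  refine integral_congr_ae (Filter.Eventually.of_forall fun p => ?_)
  simp only
  rw [← Real.exp_add, inner_add_left]
  congr 1
  ring

lemma integrable_likelihoodRatio_mul (θ φ : EuclideanSpace ℝ (Fin L)) :
    Integrable (fun y => likelihoodRatio G θ y * likelihoodRatio G φ y)
      (stdGaussian (EuclideanSpace ℝ (Fin L))) := by
  simp_rw [likelihoodRatio_mul]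
  have hθ := continuous_act_fst G θ
  have hφ := continuous_act_snd G φ
  exact integrable_integral_exp_add_inner _ (by fun_prop) continuous_const

lemma integral_likelihoodRatio_mul (θ φ : EuclideanSpace ℝ (Fin L)) :
    ∫ y, likelihoodRatio G θ y * likelihoodRatio G φ y
        ∂(stdGaussian (EuclideanSpace ℝ (Fin L)))
      = ∫ p : G × G, Real.exp (inner ℝ (act (p.1 : Matrix.orthogonalGroup (Fin L) ℝ) θ)
          (act (p.2 : Matrix.orthogonalGroup (Fin L) ℝ) φ))
          ∂((uniformMeasure G).prod (uniformMeasure G)) := by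
  simp_rw [likelihoodRatio_mul]
  have hθ := continuous_act_fst G θ
  have hφ := continuous_act_snd G φ
  rw [integral_integral_exp_add_inner _ (by fun_prop) continuous_const]
  refine integral_congr_ae (Filter.Eventually.of_forall fun p => ?_)
  simp only
  rw [norm_add_sq_real, norm_act, norm_act]
  congr 1
  ring

/-- The inner product of two likelihood ratios in `L²` of the Gaussian measure, expanded in
moment tensors. -/
lemma hasSum_integral_likelihoodRatio_mul (θ φ : EuclideanSpace ℝ (Fin L)) :
    HasSum (fun m : ℕ => inner ℝ (momentTensor G m θ) (momentTensor G m φ) / (m.factorial : ℝ))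
      (∫ y, likelihoodRatio G θ y * likelihoodRatio G φ y
        ∂(stdGaussian (EuclideanSpace ℝ (Fin L)))) := by
  have hθ := continuous_act_fst G θ
  have hφ := continuous_act_snd G φ
  let F : ℕ → G × G → ℝ := fun m p =>
    inner ℝ (act (p.1 : Matrix.orthogonalGroup (Fin L) ℝ) θ)
      (act (p.2 : Matrix.orthogonalGroup (Fin L) ℝ) φ) ^ m / (m.factorial : ℝ)
  have hF : ∀ m, Continuous (F m) := fun m => ((hθ.inner hφ).pow m).div_const _
  have hFi : ∀ m, Integrable (F m) ((uniformMeasure G).prod (uniformMeasure G)) :=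
    fun m => integrable_of_continuous_of_compactSpace _ (hF m)
  have hb : ∀ m p, ‖F m p‖ ≤ (‖θ‖ * ‖φ‖) ^ m / (m.factorial : ℝ) := by
    intro m p
    rw [norm_div, norm_pow, Real.norm_natCast]
    gcongr
    refine (norm_inner_le_norm _ _).trans ?_
    rw [norm_act, norm_act]
  have hs : Summable fun m => ∫ p, ‖F m p‖ ∂((uniformMeasure G).prod (uniformMeasure G)) := by
    refine Summable.of_nonneg_of_le (fun m => integral_nonneg fun _ => norm_nonneg _)
      (fun m => ?_) (Real.summable_pow_div_factorial (‖θ‖ * ‖φ‖))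
    refine (integral_mono (hFi m).norm (integrable_const _) (hb m)).trans (by simp)
  have h := hasSum_integral_of_summable_integral_norm hFi hs
  rw [integral_likelihoodRatio_mul]
  have h1 : ∀ m : ℕ, inner ℝ (momentTensor G m θ) (momentTensor G m φ) / (m.factorial : ℝ)
      = ∫ p, F m p ∂((uniformMeasure G).prod (uniformMeasure G)) := by
    intro m
    rw [inner_momentTensor, ← integral_div]
  have h2 : ∀ p : G × G, Real.exp (inner ℝ (act (p.1 : Matrix.orthogonalGroup (Fin L) ℝ) θ)
      (act (p.2 : Matrix.orthogonalGroup (Fin L) ℝ) φ)) = ∑' m, F m p := by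
    intro p
    rw [Real.exp_eq_exp_ℝ, NormedSpace.exp_eq_tsum_div]
  simp_rw [h1, h2]
  exact h

/-- The law of the signal at noise level one has the likelihood ratio as its Gaussian density. -/
lemma signalLaw_one (θ : EuclideanSpace ℝ (Fin L)) :
    signalLaw G 1 θ = (stdGaussian (EuclideanSpace ℝ (Fin L))).withDensity
      fun y => ENNReal.ofReal (likelihoodRatio G θ y) := by
  have hc := continuous_act_subgroup G θ
  ext s hs
  rw [signalLaw, Measure.map_apply (measurable_signal G 1 θ) hs,
    Measure.prod_apply (measurable_signal G 1 θ hs), withDensity_apply _ hs]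
  have h1 : ∀ g : G, stdGaussian (EuclideanSpace ℝ (Fin L))
      (Prod.mk g ⁻¹' ((fun p : G × EuclideanSpace ℝ (Fin L) =>
        act (p.1 : Matrix.orthogonalGroup (Fin L) ℝ) θ + (1 : ℝ) • p.2) ⁻¹' s))
      = ∫⁻ y in s, ENNReal.ofReal (Real.exp (-‖θ‖ ^ 2 / 2
          + inner ℝ (act (g : Matrix.orthogonalGroup (Fin L) ℝ) θ) y))
          ∂(stdGaussian (EuclideanSpace ℝ (Fin L))) := by
    intro g
    have h2 := congrArg (fun μ : Measure (EuclideanSpace ℝ (Fin L)) => μ s)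
      (stdGaussian_map_add (act (g : Matrix.orthogonalGroup (Fin L) ℝ) θ))
    simp only at h2
    rw [Measure.map_apply (by fun_prop) hs, withDensity_apply _ hs, norm_act] at h2
    simp_rw [one_smul]
    refine h2.trans ?_
    simp_rw [sub_eq_neg_add, neg_div]
  simp_rw [h1]
  have hcont : Continuous fun p : G × EuclideanSpace ℝ (Fin L) => Real.exp (-‖θ‖ ^ 2 / 2
      + inner ℝ (act (p.1 : Matrix.orthogonalGroup (Fin L) ℝ) θ) p.2) := by
    have := hc.comp (continuous_fst (X := G) (Y := EuclideanSpace ℝ (Fin L)))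
    simp only [Function.comp_def] at this
    fun_prop
  rw [lintegral_lintegral_swap hcont.measurable.ennreal_ofReal.aemeasurable]
  refine lintegral_congr fun y => ?_
  rw [likelihoodRatio, ofReal_integral_eq_lintegral_ofReal (integrable_exp_inner_act G θ y)
    (Filter.Eventually.of_forall fun g => (Real.exp_pos _).le)]

lemma signalLaw_eq_map {σ : ℝ} (hσ : 0 < σ) (θ : EuclideanSpace ℝ (Fin L)) :
    signalLaw G σ θ = (signalLaw G 1 (σ⁻¹ • θ)).map (fun y => σ • y) := by
  rw [signalLaw, signalLaw, Measure.map_map (by fun_prop) (measurable_signal G 1 _)]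
  congr 1
  ext1 p
  simp [act_smul, smul_smul, hσ.ne']

lemma klDiv_signalLaw_eq {σ : ℝ} (hσ : 0 < σ) (θ φ : EuclideanSpace ℝ (Fin L)) :
    InformationTheory.klDiv (signalLaw G σ θ) (signalLaw G σ φ)
      = ∫⁻ y, ENNReal.ofReal (likelihoodRatio G (σ⁻¹ • φ) y * InformationTheory.klFun
          (likelihoodRatio G (σ⁻¹ • θ) y / likelihoodRatio G (σ⁻¹ • φ) y))
          ∂(stdGaussian (EuclideanSpace ℝ (Fin L))) := by
  have h1 : IsFiniteMeasure ((stdGaussian (EuclideanSpace ℝ (Fin L))).withDensity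
      fun y => ENNReal.ofReal (likelihoodRatio G (σ⁻¹ • θ) y)) := by
    rw [← signalLaw_one]; infer_instance
  have h2 : IsFiniteMeasure ((stdGaussian (EuclideanSpace ℝ (Fin L))).withDensity
      fun y => ENNReal.ofReal (likelihoodRatio G (σ⁻¹ • φ) y)) := by
    rw [← signalLaw_one]; infer_instance
  rw [signalLaw_eq_map G hσ θ, signalLaw_eq_map G hσ φ,
    klDiv_map_eq_of_leftInverse _ _ (g := fun y => σ⁻¹ • y) (by fun_prop) (by fun_prop)
      (fun y => by simp [smul_smul, hσ.ne']), signalLaw_one, signalLaw_one,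
    klDiv_withDensity (measurable_likelihoodRatio G _) (measurable_likelihoodRatio G _)
      (fun y => (likelihoodRatio_pos G _ y).le) (likelihoodRatio_pos G _)]

/-! ### Differences of likelihood ratios -/

/-- The difference of the likelihood ratios at `θ` and `φ`. -/
def likelihoodDiff (θ φ y : EuclideanSpace ℝ (Fin L)) : ℝ :=
  likelihoodRatio G θ y - likelihoodRatio G φ y

lemma measurable_likelihoodDiff (θ φ : EuclideanSpace ℝ (Fin L)) :
    Measurable (likelihoodDiff G θ φ) :=
  (measurable_likelihoodRatio G θ).sub (measurable_likelihoodRatio G φ)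

lemma integrable_likelihoodDiff_mul (θ φ θ' φ' : EuclideanSpace ℝ (Fin L)) :
    Integrable (fun y => likelihoodDiff G θ φ y * likelihoodDiff G θ' φ' y)
      (stdGaussian (EuclideanSpace ℝ (Fin L))) := by
  have := ((integrable_likelihoodRatio_mul G θ θ').sub
    (integrable_likelihoodRatio_mul G θ φ')).sub ((integrable_likelihoodRatio_mul G φ θ').sub
    (integrable_likelihoodRatio_mul G φ φ'))
  refine this.congr (Filter.Eventually.of_forall fun y => ?_)
  simp only [likelihoodDiff, Pi.sub_apply]
  ring

/-- Scaling `θ` and `φ` by `a` multiplies the moment difference of order `m` by `a ^ m`. -/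
lemma hasSum_integral_likelihoodDiff_mul (a b : ℝ) (θ φ : EuclideanSpace ℝ (Fin L)) :
    HasSum (fun m : ℕ => (a * b) ^ m * ‖momentDiff G m θ φ‖ ^ 2 / (m.factorial : ℝ))
      (∫ y, likelihoodDiff G (a • θ) (a • φ) y * likelihoodDiff G (b • θ) (b • φ) y
        ∂(stdGaussian (EuclideanSpace ℝ (Fin L)))) := by
  have h := ((hasSum_integral_likelihoodRatio_mul G (a • θ) (b • θ)).sub
    (hasSum_integral_likelihoodRatio_mul G (a • θ) (b • φ))).sub
    ((hasSum_integral_likelihoodRatio_mul G (a • φ) (b • θ)).sub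
    (hasSum_integral_likelihoodRatio_mul G (a • φ) (b • φ)))
  have e : ∀ y, likelihoodDiff G (a • θ) (a • φ) y * likelihoodDiff G (b • θ) (b • φ) y
      = (likelihoodRatio G (a • θ) y * likelihoodRatio G (b • θ) y
        - likelihoodRatio G (a • θ) y * likelihoodRatio G (b • φ) y)
        - (likelihoodRatio G (a • φ) y * likelihoodRatio G (b • θ) y
        - likelihoodRatio G (a • φ) y * likelihoodRatio G (b • φ) y) := by
    intro y
    simp only [likelihoodDiff]
    ring
  simp_rw [e]
  rw [integral_sub, integral_sub, integral_sub]
  rotate_left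
  any_goals exact integrable_likelihoodRatio_mul G _ _
  any_goals exact (integrable_likelihoodRatio_mul G _ _).sub (integrable_likelihoodRatio_mul G _ _)
  have hm : (fun m : ℕ => (a * b) ^ m * ‖momentDiff G m θ φ‖ ^ 2 / (m.factorial : ℝ)) = fun m =>
      (inner ℝ (momentTensor G m (a • θ)) (momentTensor G m (b • θ)) / (m.factorial : ℝ)
        - inner ℝ (momentTensor G m (a • θ)) (momentTensor G m (b • φ)) / (m.factorial : ℝ))
      - (inner ℝ (momentTensor G m (a • φ)) (momentTensor G m (b • θ)) / (m.factorial : ℝ)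
        - inner ℝ (momentTensor G m (a • φ)) (momentTensor G m (b • φ)) / (m.factorial : ℝ)) := by
    ext m
    rw [← real_inner_self_eq_norm_sq, momentDiff]
    simp only [momentTensor_smul, inner_smul_left, inner_smul_right, inner_sub_left,
      inner_sub_right, conj_trivial]
    rw [mul_pow]
    ring
  rw [hm]
  exact h

/-! ### A second moment bound by smoothing -/

/-- Smoothing the likelihood ratio at `√3 u` over the second variable `η` of a rotated pair of
Gaussian vectors, tilted in the direction `x`, gives the likelihood ratio at `u` and a point shifted
by `x`. The tilt `exp (⟪x, η⟫ / √2 - ‖x‖² / 4)` is the Cameron-Martin density of the shift of `η`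
by `x / √2`, and `√2 / √3 * (x / √2) = x / √3`. -/
lemma integral_likelihoodRatio_smoothing (x ξ u : EuclideanSpace ℝ (Fin L)) :
    Integrable (fun η => likelihoodRatio G (√3 • u) ((√3)⁻¹ • ξ + (√2 * (√3)⁻¹) • η)
      * Real.exp ((√2)⁻¹ * inner ℝ x η - ‖x‖ ^ 2 / 4))
      (stdGaussian (EuclideanSpace ℝ (Fin L))) ∧
    ∫ η, likelihoodRatio G (√3 • u) ((√3)⁻¹ • ξ + (√2 * (√3)⁻¹) • η)
      * Real.exp ((√2)⁻¹ * inner ℝ x η - ‖x‖ ^ 2 / 4)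
      ∂(stdGaussian (EuclideanSpace ℝ (Fin L)))
      = likelihoodRatio G u (x + ξ) := by
  have hu := continuous_act_subgroup G u
  have h3 : √3 ≠ 0 := by positivity
  have h2 : √2 ≠ 0 := by positivity
  have h3' : √3 ^ 2 = 3 := Real.sq_sqrt (by norm_num)
  have h2' : √2 ^ 2 = 2 := Real.sq_sqrt (by norm_num)
  have e : ∀ η, likelihoodRatio G (√3 • u) ((√3)⁻¹ • ξ + (√2 * (√3)⁻¹) • η)
      * Real.exp ((√2)⁻¹ * inner ℝ x η - ‖x‖ ^ 2 / 4)
      = ∫ g : G, Real.exp ((-(3 * ‖u‖ ^ 2) / 2 - ‖x‖ ^ 2 / 4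
          + inner ℝ (act (g : Matrix.orthogonalGroup (Fin L) ℝ) u) ξ)
          + inner ℝ (√2 • act (g : Matrix.orthogonalGroup (Fin L) ℝ) u + (√2)⁻¹ • x) η)
          ∂(uniformMeasure G) := by
    intro η
    rw [likelihoodRatio, ← integral_mul_const]
    refine integral_congr_ae (Filter.Eventually.of_forall fun g => ?_)
    simp only
    rw [← Real.exp_add, act_smul, norm_smul, Real.norm_of_nonneg (Real.sqrt_nonneg 3), mul_pow,
      h3', inner_smul_left, inner_add_right, inner_smul_right, inner_smul_right, inner_add_left,
      inner_smul_left, inner_smul_left]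
    simp only [conj_trivial]
    congr 1
    field_simp
    ring
  simp_rw [e]
  refine ⟨integrable_integral_exp_add_inner _ (by fun_prop) (by fun_prop), ?_⟩
  rw [integral_integral_exp_add_inner _ (by fun_prop) (by fun_prop), likelihoodRatio]
  refine integral_congr_ae (Filter.Eventually.of_forall fun g => ?_)
  simp only
  rw [norm_add_sq_real, norm_smul, norm_smul, Real.norm_of_nonneg (Real.sqrt_nonneg 2), mul_pow,
    mul_pow, h2', norm_act, inner_smul_left, inner_smul_right, norm_inv,
    Real.norm_of_nonneg (Real.sqrt_nonneg 2), inv_pow, h2', inner_add_right]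
  simp only [conj_trivial]
  congr 1
  field_simp
  ring

/-- The Cauchy-Schwarz inequality, without integrability assumptions. -/
lemma sq_enorm_integral_mul_le {α : Type*} [MeasurableSpace α] {μ : Measure α} {f g : α → ℝ}
    (hf : AEMeasurable f μ) (hg : AEMeasurable g μ) :
    ‖∫ x, f x * g x ∂μ‖ₑ ^ 2 ≤ (∫⁻ x, ‖f x‖ₑ ^ 2 ∂μ) * ∫⁻ x, ‖g x‖ₑ ^ 2 ∂μ := by
  have h1 : ‖∫ x, f x * g x ∂μ‖ₑ ≤ ∫⁻ x, ‖f x‖ₑ * ‖g x‖ₑ ∂μ := by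
    refine (enorm_integral_le_lintegral_enorm _).trans_eq ?_
    simp_rw [enorm_mul]
  have h2 := ENNReal.lintegral_mul_le_Lp_mul_Lq μ Real.HolderConjugate.two_two hf.enorm hg.enorm
  have h3 := pow_le_pow_left' (h1.trans h2) 2
  refine h3.trans_eq ?_
  rw [mul_pow, ← ENNReal.rpow_natCast, ← ENNReal.rpow_natCast, ← ENNReal.rpow_mul,
    ← ENNReal.rpow_mul]
  simp

lemma enorm_sq_eq_ofReal (x : ℝ) : ‖x‖ₑ ^ 2 = ENNReal.ofReal (x ^ 2) := by
  rw [Real.enorm_eq_ofReal_abs, ← ENNReal.ofReal_pow (abs_nonneg x), sq_abs]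

/-- Under a Gaussian shifted by `x`, the second moment of the difference of likelihood ratios at
`u` and `v` is at most `exp (‖x‖² / 2)` times its unshifted second moment at `√3 u` and `√3 v`.
The difference at `u`, `v` is the image of the one at `√3 u`, `√3 v` under the
Ornstein-Uhlenbeck operator; the shift by `x` is moved onto the smoothing variable, where the
Cauchy-Schwarz inequality removes it. -/
lemma lintegral_likelihoodDiff_shift_sq_le (x u v : EuclideanSpace ℝ (Fin L)) :
    ∫⁻ ξ, ENNReal.ofReal (likelihoodDiff G u v (x + ξ) ^ 2)
        ∂(stdGaussian (EuclideanSpace ℝ (Fin L)))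
      ≤ ENNReal.ofReal (Real.exp (‖x‖ ^ 2 / 2))
        * ∫⁻ y, ENNReal.ofReal (likelihoodDiff G (√3 • u) (√3 • v) y ^ 2)
          ∂(stdGaussian (EuclideanSpace ℝ (Fin L))) := by
  set γ := stdGaussian (EuclideanSpace ℝ (Fin L))
  have h2' : √2 ^ 2 = 2 := Real.sq_sqrt (by norm_num)
  have h3' : √3 ^ 2 = 3 := Real.sq_sqrt (by norm_num)
  have hw : ∫⁻ η, ‖Real.exp ((√2)⁻¹ * inner ℝ x η - ‖x‖ ^ 2 / 4)‖ₑ ^ 2 ∂γ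
      = ENNReal.ofReal (Real.exp (‖x‖ ^ 2 / 2)) := by
    have e : ∀ η, Real.exp ((√2)⁻¹ * inner ℝ x η - ‖x‖ ^ 2 / 4) ^ 2
        = Real.exp (-‖x‖ ^ 2 / 2) * Real.exp (inner ℝ (√2 • x) η) := by
      intro η
      rw [← Real.exp_nat_mul, ← Real.exp_add, inner_smul_left]
      congr 1
      have : (√2)⁻¹ = √2 / 2 := by field_simp; rw [h2']
      rw [this]
      push_cast
      simp only [conj_trivial]
      ring
    simp_rw [enorm_sq_eq_ofReal, e]
    rw [← ofReal_integral_eq_lintegral_ofReal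
      ((integrable_exp_inner_stdGaussian _).const_mul _)
      (Filter.Eventually.of_forall fun η => by positivity), integral_const_mul,
      integral_exp_inner_stdGaussian, ← Real.exp_add, norm_smul,
      Real.norm_of_nonneg (Real.sqrt_nonneg 2), mul_pow, h2']
    congr 2
    ring
  have hm := measurable_likelihoodDiff G (√3 • u) (√3 • v)
  have hpt : ∀ ξ, ENNReal.ofReal (likelihoodDiff G u v (x + ξ) ^ 2)
      ≤ (∫⁻ η, ENNReal.ofReal (likelihoodDiff G (√3 • u) (√3 • v)
          ((√3)⁻¹ • ξ + (√2 * (√3)⁻¹) • η) ^ 2) ∂γ)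
        * ENNReal.ofReal (Real.exp (‖x‖ ^ 2 / 2)) := by
    intro ξ
    obtain ⟨iu, eu⟩ := integral_likelihoodRatio_smoothing G x ξ u
    obtain ⟨iv, ev⟩ := integral_likelihoodRatio_smoothing G x ξ v
    have e : likelihoodDiff G u v (x + ξ)
        = ∫ η, likelihoodDiff G (√3 • u) (√3 • v) ((√3)⁻¹ • ξ + (√2 * (√3)⁻¹) • η)
          * Real.exp ((√2)⁻¹ * inner ℝ x η - ‖x‖ ^ 2 / 4) ∂γ := by
      rw [likelihoodDiff, ← eu, ← ev, ← integral_sub iu iv]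
      simp_rw [likelihoodDiff, sub_mul]
      rfl
    rw [← enorm_sq_eq_ofReal, e, ← hw]
    simp_rw [← enorm_sq_eq_ofReal]
    exact sq_enorm_integral_mul_le (hm.comp (by fun_prop)).aemeasurable
      (Measurable.aemeasurable (by fun_prop))
  have hrot : (γ.prod γ).map (fun p => (√3)⁻¹ • p.1 + (√2 * (√3)⁻¹) • p.2) = γ :=
    stdGaussian_prod_map_add (by rw [mul_pow, inv_pow, h2', h3']; norm_num)
  have hm2 : Measurable fun y => ENNReal.ofReal (likelihoodDiff G (√3 • u) (√3 • v) y ^ 2) :=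
    (hm.pow_const 2).ennreal_ofReal
  calc ∫⁻ ξ, ENNReal.ofReal (likelihoodDiff G u v (x + ξ) ^ 2) ∂γ
      ≤ ∫⁻ ξ, (∫⁻ η, ENNReal.ofReal (likelihoodDiff G (√3 • u) (√3 • v)
          ((√3)⁻¹ • ξ + (√2 * (√3)⁻¹) • η) ^ 2) ∂γ)
        * ENNReal.ofReal (Real.exp (‖x‖ ^ 2 / 2)) ∂γ := lintegral_mono hpt
    _ = ENNReal.ofReal (Real.exp (‖x‖ ^ 2 / 2))
        * ∫⁻ y, ENNReal.ofReal (likelihoodDiff G (√3 • u) (√3 • v) y ^ 2) ∂γ := by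
      rw [lintegral_mul_const' _ _ ENNReal.ofReal_ne_top, mul_comm]
      congr 1
      conv_rhs => rw [← hrot]
      rw [lintegral_map hm2 (by fun_prop), lintegral_prod]
      exact (hm2.comp (by fun_prop)).aemeasurable

/-- Second moments of a likelihood difference under the law with density `likelihoodRatio G θ`:
average the bound for a shifted Gaussian over the orbit of `θ`. -/
lemma integrable_likelihoodDiff_sq_mul (θ u v : EuclideanSpace ℝ (Fin L)) :
    Integrable (fun y => likelihoodDiff G u v y ^ 2 * likelihoodRatio G θ y)
      (stdGaussian (EuclideanSpace ℝ (Fin L))) ∧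
    ∫ y, likelihoodDiff G u v y ^ 2 * likelihoodRatio G θ y
        ∂(stdGaussian (EuclideanSpace ℝ (Fin L)))
      ≤ Real.exp (‖θ‖ ^ 2 / 2)
        * ∫ y, likelihoodDiff G (√3 • u) (√3 • v) y * likelihoodDiff G (√3 • u) (√3 • v) y
          ∂(stdGaussian (EuclideanSpace ℝ (Fin L))) := by
  set γ := stdGaussian (EuclideanSpace ℝ (Fin L))
  have hm := measurable_likelihoodDiff G u v
  have hmθ := measurable_likelihoodRatio G θ
  have hnn : ∀ y, 0 ≤ likelihoodDiff G u v y ^ 2 * likelihoodRatio G θ y := fun y =>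
    mul_nonneg (sq_nonneg _) (likelihoodRatio_pos G θ y).le
  have hms : AEStronglyMeasurable
      (fun y => likelihoodDiff G u v y ^ 2 * likelihoodRatio G θ y) γ :=
    ((hm.pow_const 2).mul hmθ).aestronglyMeasurable
  have hm2 : Measurable fun y => ENNReal.ofReal (likelihoodDiff G u v y ^ 2) :=
    (hm.pow_const 2).ennreal_ofReal
  have key : ∫⁻ y, ENNReal.ofReal (likelihoodDiff G u v y ^ 2 * likelihoodRatio G θ y) ∂γ
      ≤ ENNReal.ofReal (Real.exp (‖θ‖ ^ 2 / 2)
        * ∫ y, likelihoodDiff G (√3 • u) (√3 • v) y * likelihoodDiff G (√3 • u) (√3 • v) y ∂γ) := by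
    calc ∫⁻ y, ENNReal.ofReal (likelihoodDiff G u v y ^ 2 * likelihoodRatio G θ y) ∂γ
        = ∫⁻ y, ENNReal.ofReal (likelihoodDiff G u v y ^ 2) ∂(signalLaw G 1 θ) := by
          rw [signalLaw_one, lintegral_withDensity_eq_lintegral_mul _ hmθ.ennreal_ofReal hm2]
          refine lintegral_congr fun y => ?_
          rw [Pi.mul_apply, ENNReal.ofReal_mul (sq_nonneg _), mul_comm]
      _ = ∫⁻ g : G, ∫⁻ ξ, ENNReal.ofReal (likelihoodDiff G u v
            (act (g : Matrix.orthogonalGroup (Fin L) ℝ) θ + ξ) ^ 2) ∂γ ∂(uniformMeasure G) := by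
          rw [signalLaw, lintegral_map hm2 (measurable_signal G 1 θ), lintegral_prod]
          · simp_rw [one_smul]
            rfl
          · exact (hm2.comp (measurable_signal G 1 θ)).aemeasurable
      _ ≤ ∫⁻ _ : G, ENNReal.ofReal (Real.exp (‖θ‖ ^ 2 / 2))
            * ∫⁻ y, ENNReal.ofReal (likelihoodDiff G (√3 • u) (√3 • v) y ^ 2) ∂γ
            ∂(uniformMeasure G) := by
          refine lintegral_mono fun g => ?_
          have := lintegral_likelihoodDiff_shift_sq_le G
            (act (g : Matrix.orthogonalGroup (Fin L) ℝ) θ) u v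
          rwa [norm_act] at this
      _ = _ := by
          rw [lintegral_const, measure_univ, mul_one, ENNReal.ofReal_mul (Real.exp_pos _).le,
            ofReal_integral_eq_lintegral_ofReal (integrable_likelihoodDiff_mul G _ _ _ _)
            (Filter.Eventually.of_forall fun y => mul_self_nonneg _)]
          simp_rw [sq]
          rfl
  have hint : Integrable (fun y => likelihoodDiff G u v y ^ 2 * likelihoodRatio G θ y) γ :=
    (lintegral_ofReal_ne_top_iff_integrable hms (Filter.Eventually.of_forall hnn)).1
      (ne_top_of_le_ne_top ENNReal.ofReal_ne_top key)
  refine ⟨hint, ?_⟩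
  rw [← ofReal_integral_eq_lintegral_ofReal hint (Filter.Eventually.of_forall hnn)] at key
  exact (ENNReal.ofReal_le_ofReal_iff (mul_nonneg (Real.exp_pos _).le
    (integral_nonneg fun y => mul_self_nonneg _))).1 key

/-! ### The two bounds at noise level one -/

/-- The series of the lower bound as the inner product of a likelihood difference with its
contraction by `1 / 3`. -/
lemma hasSum_momentDiff_third (u v : EuclideanSpace ℝ (Fin L)) :
    HasSum (fun m : ℕ => (1 / 3) ^ m * ‖momentDiff G m u v‖ ^ 2 / (m.factorial : ℝ))
      (∫ y, likelihoodDiff G ((1 / 3 : ℝ) • u) ((1 / 3 : ℝ) • v) y * likelihoodDiff G u v y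
        ∂(stdGaussian (EuclideanSpace ℝ (Fin L)))) := by
  have h := hasSum_integral_likelihoodDiff_mul G (1 / 3) 1 u v
  simp only [mul_one, one_smul] at h
  exact h

/-- The lower bound. The test function separating the two laws is the difference of the likelihood
ratios at `u / 3` and `v / 3`. The difference of its expectations is the sum of the series, which
also bounds its second moments under the two laws, up to the factors `exp (‖u‖² / 2)` and
`exp (‖v‖² / 2)`. -/
lemma ofReal_tsum_momentDiff_le_lintegral {u v : EuclideanSpace ℝ (Fin L)}
    (hu : Real.exp (‖u‖ ^ 2 / 2) ≤ 3) (hv : Real.exp (‖v‖ ^ 2 / 2) ≤ 3) :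
    ENNReal.ofReal (1 / 12 *
        ∑' m : ℕ, (1 / 3) ^ m * ‖momentDiff G m u v‖ ^ 2 / (m.factorial : ℝ))
      ≤ ∫⁻ y, ENNReal.ofReal (likelihoodRatio G v y * InformationTheory.klFun
          (likelihoodRatio G u y / likelihoodRatio G v y))
          ∂(stdGaussian (EuclideanSpace ℝ (Fin L))) := by
  set γ := stdGaussian (EuclideanSpace ℝ (Fin L)) with hγ
  have hψm : Measurable fun y => likelihoodRatio G v y * InformationTheory.klFun
      (likelihoodRatio G u y / likelihoodRatio G v y) :=
    (measurable_likelihoodRatio G v).mul (InformationTheory.measurable_klFun.comp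
      ((measurable_likelihoodRatio G u).div (measurable_likelihoodRatio G v)))
  have hψ0 : ∀ y, 0 ≤ likelihoodRatio G v y * InformationTheory.klFun
      (likelihoodRatio G u y / likelihoodRatio G v y) := fun y =>
    mul_nonneg (likelihoodRatio_pos G v y).le (InformationTheory.klFun_nonneg
      (div_pos (likelihoodRatio_pos G u y) (likelihoodRatio_pos G v y)).le)
  -- An infinite divergence needs no proof; a finite one makes its integrand integrable.
  by_cases htop : ∫⁻ y, ENNReal.ofReal (likelihoodRatio G v y * InformationTheory.klFun
          (likelihoodRatio G u y / likelihoodRatio G v y)) ∂γ = ⊤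
  · rw [htop]
    exact le_top
  have hψ := (lintegral_ofReal_ne_top_iff_integrable hψm.aestronglyMeasurable
    (Filter.Eventually.of_forall hψ0)).1 htop
  rw [← ofReal_integral_eq_lintegral_ofReal hψ (Filter.Eventually.of_forall hψ0)]
  refine ENNReal.ofReal_le_ofReal ?_
  rw [(hasSum_momentDiff_third G u v).tsum_eq, ← hγ]
  set u' := (1 / 3 : ℝ) • u
  set v' := (1 / 3 : ℝ) • v
  have hs : ∫ y, likelihoodDiff G (√3 • u') (√3 • v') y * likelihoodDiff G (√3 • u') (√3 • v') y ∂γ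
      = ∫ y, likelihoodDiff G u' v' y * likelihoodDiff G u v y ∂γ := by
    have h1 := hasSum_integral_likelihoodDiff_mul G (√3 * (1 / 3)) (√3 * (1 / 3)) u v
    have h2 : √3 * (1 / 3) * (√3 * (1 / 3)) = 1 / 3 := by
      have : √3 * √3 = 3 := Real.mul_self_sqrt (by norm_num)
      linear_combination (1 / 9 : ℝ) * this
    rw [h2, ← smul_smul, ← smul_smul] at h1
    exact h1.unique (hasSum_momentDiff_third G u v)
  obtain ⟨iu, bu⟩ := integrable_likelihoodDiff_sq_mul G u u' v'
  obtain ⟨iv, bv⟩ := integrable_likelihoodDiff_sq_mul G v u' v'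
  rw [hs, ← hγ] at bu bv
  have hδ0 : 0 ≤ ∫ y, likelihoodDiff G u' v' y * likelihoodDiff G u v y ∂γ := by
    rw [← hs]
    exact integral_nonneg fun y => mul_self_nonneg _
  -- The weight `1 / 12` leaves half of the left side after both second moments, at most three
  -- times the left side each, are subtracted.
  have hle : ∫ y, likelihoodDiff G u' v' y * likelihoodDiff G u v y ∂γ
      ≤ ∫ y, (1 / 12 * (likelihoodDiff G u' v' y ^ 2 * likelihoodRatio G u y
          + likelihoodDiff G u' v' y ^ 2 * likelihoodRatio G v y)
        + likelihoodRatio G v y * InformationTheory.klFun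
          (likelihoodRatio G u y / likelihoodRatio G v y) / (2 * (1 / 12))) ∂γ :=
    integral_mono (integrable_likelihoodDiff_mul G _ _ _ _)
      (((iu.add iv).const_mul _).add (hψ.div_const _)) fun y =>
        mul_sub_le_add_klFun (likelihoodRatio_pos G u y) (likelihoodRatio_pos G v y) _
          (by norm_num)
  have hadd : Integrable (fun y => 1 / 12 * (likelihoodDiff G u' v' y ^ 2 * likelihoodRatio G u y
      + likelihoodDiff G u' v' y ^ 2 * likelihoodRatio G v y)) γ := (iu.add iv).const_mul _
  rw [integral_add hadd (hψ.div_const _), integral_const_mul, integral_div,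
    integral_add iu iv, ← hγ, show (2 : ℝ) * (1 / 12) = 6⁻¹ by norm_num, div_inv_eq_mul] at hle
  have h3u := bu.trans (mul_le_mul_of_nonneg_right hu hδ0)
  have h3v := bv.trans (mul_le_mul_of_nonneg_right hv hδ0)
  linarith

/-- The upper bound with all orders. The constant `2` absorbs `e / 2`, half the inverse of the lower
bound `exp (-1)` on both likelihood ratios. -/
lemma lintegral_klFun_le_tsum_momentDiff {u v : EuclideanSpace ℝ (Fin L)}
    (hu : ‖u‖ ^ 2 ≤ 2) (hv : ‖v‖ ^ 2 ≤ 2) (hu0 : meanVector G u = 0)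
    (hv0 : meanVector G v = 0) :
    ∫⁻ y, ENNReal.ofReal (likelihoodRatio G v y * InformationTheory.klFun
          (likelihoodRatio G u y / likelihoodRatio G v y))
          ∂(stdGaussian (EuclideanSpace ℝ (Fin L)))
      ≤ ENNReal.ofReal (2 * ∑' m : ℕ, ‖momentDiff G m u v‖ ^ 2 / (m.factorial : ℝ)) := by
  set γ := stdGaussian (EuclideanSpace ℝ (Fin L))
  have h := hasSum_integral_likelihoodDiff_mul G 1 1 u v
  simp only [mul_one, one_smul, one_pow, one_mul] at h
  have hi := (integrable_likelihoodDiff_mul G u v u v).const_mul (2 : ℝ)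
  rw [h.tsum_eq, ← integral_const_mul, ofReal_integral_eq_lintegral_ofReal hi
    (Filter.Eventually.of_forall fun y => by
      have := mul_self_nonneg (likelihoodDiff G u v y)
      positivity)]
  refine lintegral_mono fun y => ENNReal.ofReal_le_ofReal ?_
  have hpu : Real.exp (-1) ≤ likelihoodRatio G u y :=
    (Real.exp_le_exp.2 (by linarith)).trans (exp_le_likelihoodRatio G hu0 y)
  have hpv : Real.exp (-1) ≤ likelihoodRatio G v y :=
    (Real.exp_le_exp.2 (by linarith)).trans (exp_le_likelihoodRatio G hv0 y)
  refine (mul_klFun_div_le (Real.exp_pos _) hpu hpv).trans ?_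
  have he : Real.exp 1 ≤ 4 := by linarith [Real.exp_one_lt_d9]
  have hd : (likelihoodRatio G u y - likelihoodRatio G v y) ^ 2 / (2 * Real.exp (-1))
      = Real.exp 1 / 2 * (likelihoodDiff G u v y * likelihoodDiff G u v y) := by
    rw [Real.exp_neg, likelihoodDiff]
    field_simp
  rw [hd]
  have := mul_self_nonneg (likelihoodDiff G u v y)
  nlinarith

/-- The factor `m² (4 / 3)^(2 m - 2)` from the Lipschitz bound on tensor powers is at most
`4^m 2^m = 8^m`, which is summable against `1 / m!`. -/
lemma momentDiff_sq_div_factorial_le {u v : EuclideanSpace ℝ (Fin L)} (hu : ‖u‖ ≤ 1)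
    (hv : ‖v‖ ≤ 4 / 3 * ‖u‖) {k m : ℕ} (hk : 1 ≤ k) (hkm : k ≤ m) :
    ‖momentDiff G m u v‖ ^ 2 / (m.factorial : ℝ)
      ≤ 8 ^ m / (m.factorial : ℝ) * (‖u‖ ^ (2 * k - 2) * orbitDist G u v ^ 2) := by
  have hρ := orbitDist_nonneg G u v
  have h := norm_momentDiff_le G m (θ := u) (φ := v) (M := 4 / 3 * ‖u‖)
    (by linarith [norm_nonneg u]) hv
  obtain ⟨n, rfl⟩ : ∃ n, m = n + 1 := ⟨m - 1, by omega⟩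
  rw [Nat.add_sub_cancel] at h
  have h1 : ((n + 1 : ℕ) : ℝ) ≤ 2 ^ (n + 1) := by
    exact_mod_cast (Nat.lt_two_pow_self (n := n + 1)).le
  have h2 : ‖u‖ ^ (2 * n) ≤ ‖u‖ ^ (2 * k - 2) :=
    pow_le_pow_of_le_one (norm_nonneg u) hu (by omega)
  have h3 : ((4 / 3 : ℝ) ^ n) ^ 2 ≤ 2 ^ (n + 1) := by
    calc ((4 / 3 : ℝ) ^ n) ^ 2 = (16 / 9) ^ n := by rw [← pow_mul, mul_comm, pow_mul]; norm_num
      _ ≤ 2 ^ n := by gcongr; norm_num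
      _ ≤ 2 ^ (n + 1) := by gcongr <;> norm_num
  rw [div_mul_eq_mul_div]
  gcongr
  calc ‖momentDiff G (n + 1) u v‖ ^ 2
      ≤ (((n + 1 : ℕ) : ℝ) * (4 / 3 * ‖u‖) ^ n * orbitDist G u v) ^ 2 := by gcongr
    _ = ((n + 1 : ℕ) : ℝ) ^ 2 * ((4 / 3) ^ n) ^ 2 * (‖u‖ ^ (2 * n) * orbitDist G u v ^ 2) := by
      ring
    _ ≤ (2 ^ (n + 1)) ^ 2 * 2 ^ (n + 1) * (‖u‖ ^ (2 * k - 2) * orbitDist G u v ^ 2) := by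
      gcongr
    _ = 8 ^ (n + 1) * (‖u‖ ^ (2 * k - 2) * orbitDist G u v ^ 2) := by
      rw [← pow_mul, mul_comm (n + 1) 2, pow_mul, ← mul_pow]; norm_num

lemma tsum_momentDiff_le {u v : EuclideanSpace ℝ (Fin L)} (hu : ‖u‖ ≤ 1)
    (hv : ‖v‖ ≤ 4 / 3 * ‖u‖) {k : ℕ} (hk : 1 ≤ k) :
    ∑' m : ℕ, ‖momentDiff G m u v‖ ^ 2 / (m.factorial : ℝ)
      ≤ ∑ m ∈ Finset.Ico 1 k, ‖momentDiff G m u v‖ ^ 2 / (m.factorial : ℝ)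
        + Real.exp 8 * (‖u‖ ^ (2 * k - 2) * orbitDist G u v ^ 2) := by
  have h := hasSum_integral_likelihoodDiff_mul G 1 1 u v
  simp only [mul_one, one_smul, one_pow, one_mul] at h
  rw [← h.summable.sum_add_tsum_nat_add k, Finset.range_eq_Ico,
    Finset.sum_eq_sum_Ico_succ_bot (by omega), momentDiff_zero]
  simp only [norm_zero, ne_eq, OfNat.ofNat_ne_zero, not_false_eq_true, zero_pow, zero_div, zero_add]
  gcongr
  have hexp : HasSum (fun m : ℕ => (8 : ℝ) ^ m / (m.factorial : ℝ)) (Real.exp 8) := by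
    rw [Real.exp_eq_exp_ℝ]
    exact NormedSpace.expSeries_div_hasSum_exp (8 : ℝ)
  have hexpk : ∑' n : ℕ, (8 : ℝ) ^ (n + k) / ((n + k).factorial : ℝ) ≤ Real.exp 8 := by
    rw [← hexp.tsum_eq, ← hexp.summable.sum_add_tsum_nat_add k]
    exact le_add_of_nonneg_left (Finset.sum_nonneg fun m _ => by positivity)
  have hsk := (summable_nat_add_iff k).2 hexp.summable
  calc ∑' n : ℕ, ‖momentDiff G (n + k) u v‖ ^ 2 / ((n + k).factorial : ℝ)
      ≤ ∑' n : ℕ, 8 ^ (n + k) / ((n + k).factorial : ℝ)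
          * (‖u‖ ^ (2 * k - 2) * orbitDist G u v ^ 2) :=
        ((summable_nat_add_iff k).2 h.summable).tsum_le_tsum
          (fun n => momentDiff_sq_div_factorial_le G hu hv hk (by omega))
          (hsk.mul_right _)
    _ = (∑' n : ℕ, 8 ^ (n + k) / ((n + k).factorial : ℝ))
          * (‖u‖ ^ (2 * k - 2) * orbitDist G u v ^ 2) := tsum_mul_right
    _ ≤ Real.exp 8 * (‖u‖ ^ (2 * k - 2) * orbitDist G u v ^ 2) := by
        gcongr

lemma meanVector_smul (c : ℝ) (θ : EuclideanSpace ℝ (Fin L)) :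
    meanVector G (c • θ) = c • meanVector G θ := by
  simp_rw [meanVector, act_smul, integral_smul]

end OrbitModel

end

theorem mainTheorem3 :
    ∃ c C : ℝ, 0 < c ∧ 0 < C ∧
      ∀ (L : ℕ) (G : Subgroup (Matrix.orthogonalGroup (Fin L) ℝ)) [CompactSpace G]
        (σ : ℝ) (θ φ : EuclideanSpace ℝ (Fin L)),
        0 < σ →
        3 * OrbitModel.orbitDist G θ φ ≤ ‖θ‖ →
        ‖θ‖ ≤ σ →
        OrbitModel.meanVector G θ = 0 →
        OrbitModel.meanVector G φ = 0 →
        -- the series, indexed by `m = n + 1 ≥ 1`, converges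
        (Summable fun n : ℕ => ‖OrbitModel.momentDiff G (n + 1) θ φ‖ ^ 2 /
          ((√3 * σ) ^ (2 * (n + 1)) * (Nat.factorial (n + 1) : ℝ))) ∧
        -- the lower bound
        ENNReal.ofReal (c * ∑' n : ℕ, ‖OrbitModel.momentDiff G (n + 1) θ φ‖ ^ 2 /
            ((√3 * σ) ^ (2 * (n + 1)) * (Nat.factorial (n + 1) : ℝ))) ≤
          InformationTheory.klDiv (OrbitModel.signalLaw G σ θ) (OrbitModel.signalLaw G σ φ) ∧
        -- the upper bounds; in particular the divergence is finite
        ∀ k : ℕ, 1 ≤ k →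
          InformationTheory.klDiv (OrbitModel.signalLaw G σ θ) (OrbitModel.signalLaw G σ φ) ≤
            ENNReal.ofReal
              (2 * ∑ m ∈ Finset.Ico 1 k, ‖OrbitModel.momentDiff G m θ φ‖ ^ 2 /
                  (σ ^ (2 * m) * (Nat.factorial m : ℝ)) +
                C * (‖θ‖ ^ (2 * k - 2) * OrbitModel.orbitDist G θ φ ^ 2 / σ ^ (2 * k))) := by
  -- `1 / 12` comes from the variational inequality; `exp 8` is the sum of `8 ^ m / m!`.
  refine ⟨1 / 12, 2 * Real.exp 8, by norm_num, by positivity, ?_⟩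
  intro L G _ σ θ φ hσ hρ hθ hθ0 hφ0
  rw [OrbitModel.klDiv_signalLaw_eq G hσ]
  set u := σ⁻¹ • θ with hu_def
  set v := σ⁻¹ • φ with hv_def
  have hnu : ‖u‖ = σ⁻¹ * ‖θ‖ := by rw [norm_smul, Real.norm_of_nonneg (by positivity)]
  have hρ' : OrbitModel.orbitDist G u v = σ⁻¹ * OrbitModel.orbitDist G θ φ :=
    OrbitModel.orbitDist_smul G (by positivity) θ φ
  have hu1 : ‖u‖ ≤ 1 := by
    rw [hnu, inv_mul_le_iff₀ hσ, mul_one]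
    exact hθ
  have hρ3 : 3 * OrbitModel.orbitDist G u v ≤ ‖u‖ := by
    rw [hnu, hρ', mul_left_comm]
    gcongr
  have hv : ‖v‖ ≤ 4 / 3 * ‖u‖ := by linarith [OrbitModel.norm_le_add_orbitDist G u v]
  have hu2 : ‖u‖ ^ 2 ≤ 2 := by nlinarith [norm_nonneg u]
  have hv2 : ‖v‖ ^ 2 ≤ 2 := by nlinarith [norm_nonneg u, norm_nonneg v]
  have he : Real.exp 1 ≤ 3 := by linarith [Real.exp_one_lt_d9]
  have hm : ∀ m, ‖OrbitModel.momentDiff G m u v‖ ^ 2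
      = ‖OrbitModel.momentDiff G m θ φ‖ ^ 2 / σ ^ (2 * m) := by
    intro m
    rw [hu_def, hv_def, OrbitModel.momentDiff_smul, norm_smul,
      Real.norm_of_nonneg (by positivity), mul_pow, inv_pow, inv_pow, ← pow_mul, mul_comm m 2]
    ring
  -- The series at noise level one; its term of order zero vanishes.
  have hterm : ∀ n : ℕ, ‖OrbitModel.momentDiff G (n + 1) θ φ‖ ^ 2 /
      ((√3 * σ) ^ (2 * (n + 1)) * (Nat.factorial (n + 1) : ℝ))
      = (1 / 3) ^ (n + 1) * ‖OrbitModel.momentDiff G (n + 1) u v‖ ^ 2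
        / ((n + 1).factorial : ℝ) := by
    intro n
    have h3 : √3 ^ (2 * (n + 1)) = 3 ^ (n + 1) := by
      rw [pow_mul, Real.sq_sqrt (by norm_num)]
    rw [hm, mul_pow, h3, one_div, inv_pow]
    field_simp
  have hsum := (OrbitModel.hasSum_momentDiff_third G u v).summable
  simp_rw [hterm]
  refine ⟨(summable_nat_add_iff 1).2 hsum, ?_, fun k hk => ?_⟩
  · have h0 := hsum.sum_add_tsum_nat_add 1
    simp only [Finset.range_one, Finset.sum_singleton, OrbitModel.momentDiff_zero, norm_zero,
      ne_eq, OfNat.ofNat_ne_zero, not_false_eq_true, zero_pow, mul_zero, zero_div, zero_add] at h0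
    rw [h0]
    exact OrbitModel.ofReal_tsum_momentDiff_le_lintegral G
      ((Real.exp_le_exp.2 (by linarith)).trans he) ((Real.exp_le_exp.2 (by linarith)).trans he)
  · refine (OrbitModel.lintegral_klFun_le_tsum_momentDiff G hu2 hv2
      (by rw [hu_def, OrbitModel.meanVector_smul, hθ0, smul_zero])
      (by rw [hv_def, OrbitModel.meanVector_smul, hφ0, smul_zero])).trans
      (ENNReal.ofReal_le_ofReal ?_)
    have hrem : ‖u‖ ^ (2 * k - 2) * OrbitModel.orbitDist G u v ^ 2
        = ‖θ‖ ^ (2 * k - 2) * OrbitModel.orbitDist G θ φ ^ 2 / σ ^ (2 * k) := by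
      obtain ⟨j, rfl⟩ : ∃ j, k = j + 1 := ⟨k - 1, by omega⟩
      rw [hnu, hρ', show 2 * (j + 1) - 2 = 2 * j by omega, show 2 * (j + 1) = 2 * j + 2 by ring,
        mul_pow, mul_pow, inv_pow, inv_pow]
      field_simp
      ring
    have h := OrbitModel.tsum_momentDiff_le G hu1 hv hk
    rw [hrem] at h
    simp_rw [hm, div_div] at h ⊢
    linarith
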